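/- Proposition 3.1. Let $H$ be a compact Lie group with simple Lie algebra $\mathfrak h$ and Killing form $B_{\mathfrak h}$, and let $K\subset H$ be a closed subgroup with Lie algebra $\mathfrak k$ such that $H/K$ is an irreducible symmetric space; that is, $\mathfrak k$ is the fixed point set of an involutive automorphism of $\mathfrak h$, and $\mathrm{Ad}(K)$ acts irreducibly on the ($\neq 0$) $B_{\mathfrak h}$-orthogonal complement $\mathfrak q$ of $\mathfrak k$ in $\mathfrak h$. Put $d=\dim K$ and $n=\dim H/K=\dim\mathfrak q$. Let $\Delta K=\{(k,k):k\in K\}\subset H\times H$ and let $M=H\times H/\Delta K$, with its standard smooth structure, the one for which the projection $H\times H\to M$ is a smooth submersion; the tangent space of $M$ at the base point is identified, through the differential of the projection, with $$\mathfrak p=\mathfrak p_1\oplus\mathfrak p_2\oplus\mathfrak p_3,\qquad \mathfrak p_1=(\mathfrak q,0),\quad \mathfrak p_2=(0,\mathfrak q),\quad \mathfrak p_3=\{(Z,-Z):Z\in\mathfrak k\}.$$ Let $x_1,x_2,x_3>0$ and $x_4\in\mathbb R$ with $x_1x_2>x_4^2$, and let $g=(x_1,x_2,x_3,x_4)$ denote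 the $H\times H$-invariant Riemannian metric on $M$ which at the base point satisfies, for all $X_1,X_2,Y_1,Y_2\in\mathfrak q$ and $Z,W\in\mathfrak k$, $$g((X_1,X_2),(Y_1,Y_2))=-x_1B_{\mathfrak h}(X_1,Y_1)-x_2B_{\mathfrak h}(X_2,Y_2)-x_4\big(B_{\mathfrak h}(X_1,Y_2)+B_{\mathfrak h}(X_2,Y_1)\big),$$ $$g((Z,-Z),(W,-W))=-2x_3B_{\mathfrak h}(Z,W),\qquad g((X_1,X_2),(Z,-Z))=0.$$ Then the scalar curvature of $g$ at every point of $M$ is $$\mathrm{Sc}(g)=\frac{d}{2x_3}-\frac{n\left(x_2^2x_3^2+x_1^2(4x_2^2-8x_2x_3+x_3^2)+8x_2x_3x_4^2+8x_1x_3(x_4^2-x_2^2)-2x_4^2(x_3^2+2x_4^2)\right)}{16x_3(x_4^2-x_1x_2)^2}.$$ -/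

import Mathlib

open Bundle Manifold
open scoped ContDiff

noncomputable section

/-! ### Curvature of a field of bilinear forms on a vector space

`G u` is the metric tensor at the point `u` of (an open set of) the finite-dimensional space `F`.
Everything below is meaningful at points near which `G` is smooth and nondegenerate. -/

section LocalCurvature

variable {F : Type*} [NormedAddCommGroup F] [NormedSpace ℝ F]

/-- The Christoffel symbols of the first kind, as a linear form in `y`:
`y ↦ ½ (∂_v G(w, y) + ∂_w G(v, y) - ∂_y G(v, w))`. -/
def christoffelLower (G : F → F →L[ℝ] F →L[ℝ] ℝ) (u v w : F) : F →L[ℝ] ℝ :=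
  (1 / 2 : ℝ) • (fderiv ℝ G u v w + fderiv ℝ G u w v - ((fderiv ℝ G u).flip v).flip w)

/-- The defining formula of the Christoffel symbols of the first kind. -/
theorem christoffelLower_apply (G : F → F →L[ℝ] F →L[ℝ] ℝ) (u v w y : F) :
    christoffelLower G u v w y =
      (1 / 2 : ℝ) * (fderiv ℝ G u v w y + fderiv ℝ G u w v y - fderiv ℝ G u y v w) := by
  simp [christoffelLower]

/-- The Christoffel symbols of the second kind `Γ_u(v, w)`, determined by
`G_u(Γ_u(v, w), y) = christoffelLower G u v w y` for all `y`. The Levi-Civita connection of `G` is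
`∇_v W = ∂_v W + Γ(v, W)`. -/
def christoffel (G : F → F →L[ℝ] F →L[ℝ] ℝ) (u v w : F) : F :=
  (G u).inverse (christoffelLower G u v w)

/-- The Riemann curvature tensor `R(v, w) z = ∇_v ∇_w z - ∇_w ∇_v z`, for constant vector fields
`v`, `w`, `z`. -/
def localRiemann (G : F → F →L[ℝ] F →L[ℝ] ℝ) (u v w z : F) : F :=
  fderiv ℝ (fun u' => christoffel G u' w z) u v - fderiv ℝ (fun u' => christoffel G u' v z) u w
    + christoffel G u v (christoffel G u w z) - christoffel G u w (christoffel G u v z)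

variable [FiniteDimensional ℝ F]

/-- The Ricci tensor: `Ric(w, z)` is the trace of `v ↦ R(v, w) z`, computed in a basis of `F`. -/
def localRicci (G : F → F →L[ℝ] F →L[ℝ] ℝ) (u w z : F) : ℝ :=
  ∑ i, (Module.finBasis ℝ F).coord i (localRiemann G u (Module.finBasis ℝ F i) w z)

/-- The coefficients `G^{ij}` of the inverse of the metric tensor, in a basis of `F`. -/
def inverseMetric (G : F → F →L[ℝ] F →L[ℝ] ℝ) (u : F) (i j : Fin (Module.finrank ℝ F)) : ℝ :=
  (Module.finBasis ℝ F).coord i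
    ((G u).inverse ((Module.finBasis ℝ F).coord j).toContinuousLinearMap)

/-- The scalar curvature: the `G`-trace `∑ G^{ij} Ric_{ij}` of the Ricci tensor. -/
def localScalar (G : F → F →L[ℝ] F →L[ℝ] ℝ) (u : F) : ℝ :=
  ∑ i, ∑ j, inverseMetric G u i j *
    localRicci G u (Module.finBasis ℝ F i) (Module.finBasis ℝ F j)

end LocalCurvature

/-! ### Scalar curvature of a Riemannian manifold -/

section Riemannian

variable {F : Type*} [NormedAddCommGroup F] [NormedSpace ℝ F] [FiniteDimensional ℝ F]
  {M : Type*} [TopologicalSpace M] [ChartedSpace F M] [IsManifold 𝓘(ℝ, F) ∞ M]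

/-- A smooth Riemannian metric on `M`. -/
abbrev SmoothMetric (F : Type*) [NormedAddCommGroup F] [NormedSpace ℝ F]
    (M : Type*) [TopologicalSpace M] [ChartedSpace F M] [IsManifold 𝓘(ℝ, F) ∞ M] :=
  ContMDiffRiemannianMetric 𝓘(ℝ, F) ∞ F (fun x : M => TangentSpace 𝓘(ℝ, F) x)

/-- The expression of the metric `g` in the chart around `p`: the pullback of `g` under the inverse
of the chart (relevant on the open target of the chart). -/
def SmoothMetric.inChart (g : SmoothMetric F M) (p : M) (u : F) : F →L[ℝ] F →L[ℝ] ℝ :=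
  let L : F →L[ℝ] F := mfderiv 𝓘(ℝ, F) 𝓘(ℝ, F) (extChartAt 𝓘(ℝ, F) p).symm u
  let B : F →L[ℝ] F →L[ℝ] ℝ := g.inner ((extChartAt 𝓘(ℝ, F) p).symm u)
  B.bilinearComp L L

/-- The scalar curvature of the Riemannian metric `g` at `p`, computed in the chart around `p`. -/
def SmoothMetric.scalarCurvature (g : SmoothMetric F M) (p : M) : ℝ :=
  localScalar (g.inChart p) (extChartAt 𝓘(ℝ, F) p p)

end Riemannian

/-! ### Closed subgroups of Lie groups and symmetric pairs -/

section LieGroups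

instance minSmoothness_real_three_leInfty : ENat.LEInfty (minSmoothness ℝ 3) :=
  ⟨by rw [minSmoothness_of_isRCLikeNormedField]; exact ENat.LEInfty.out⟩

variable {E : Type*} [NormedAddCommGroup E] [NormedSpace ℝ E]
  {H : Type*} [TopologicalSpace H] [ChartedSpace E H] [Group H]

/-- The Lie algebra of a Lie group `H` modelled on `E`. -/
abbrev LieAlg (E : Type*) [NormedAddCommGroup E] [NormedSpace ℝ E]
    (H : Type*) [TopologicalSpace H] [ChartedSpace E H] [Group H] : Type _ :=
  GroupLieAlgebra 𝓘(ℝ, E) H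

/-- The adjoint representation `Ad(h)` of `H` on its Lie algebra: the differential at `1` of the
conjugation by `h`. -/
def adjointRep (h : H) : LieAlg E H →L[ℝ] LieAlg E H :=
  mfderiv 𝓘(ℝ, E) 𝓘(ℝ, E) (fun x : H => h * x * h⁻¹) (1 : H)

variable [LieGroup 𝓘(ℝ, E) ∞ H]

/-- The differential of the multiplication at `(1, 1)` is the addition. -/
theorem hasMFDerivAt_mul_of_eq_one {a b : H} (ha : a = 1) (hb : b = 1) :
    HasMFDerivAt (𝓘(ℝ, E).prod 𝓘(ℝ, E)) 𝓘(ℝ, E) (fun q : H × H => q.1 * q.2) (a, b)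
      (ContinuousLinearMap.fst ℝ E E + ContinuousLinearMap.snd ℝ E E) := by
  subst ha hb
  have hm : MDifferentiableAt (𝓘(ℝ, E).prod 𝓘(ℝ, E)) 𝓘(ℝ, E)
      (fun q : H × H => q.1 * q.2) (1, 1) :=
    (contMDiff_mul 𝓘(ℝ, E) (∞ : ℕ∞ω)).mdifferentiableAt (by simp)
  have h := hm.hasMFDerivAt
  have e : (mfderiv (𝓘(ℝ, E).prod 𝓘(ℝ, E)) 𝓘(ℝ, E)
      (fun q : H × H => q.1 * q.2) (1, 1) : E × E →L[ℝ] E) =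
      ContinuousLinearMap.fst ℝ E E + ContinuousLinearMap.snd ℝ E E := by
    refine ContinuousLinearMap.ext fun v => ?_
    refine (mfderiv_prod_eq_add_apply hm (v := v)).trans ?_
    have e1 : HasMFDerivAt 𝓘(ℝ, E) 𝓘(ℝ, E) (fun z : H => z * 1) 1
        (ContinuousLinearMap.id ℝ E) :=
      (hasMFDerivAt_id (1 : H)).congr_of_eventuallyEq (Filter.Eventually.of_forall mul_one)
    have e2 : HasMFDerivAt 𝓘(ℝ, E) 𝓘(ℝ, E) (fun z : H => 1 * z) 1
        (ContinuousLinearMap.id ℝ E) :=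
      (hasMFDerivAt_id (1 : H)).congr_of_eventuallyEq (Filter.Eventually.of_forall one_mul)
    exact congrArg₂ (fun (A B : E →L[ℝ] E) => A (Prod.fst (v : E × E)) + B (Prod.snd (v : E × E)))
      e1.mfderiv e2.mfderiv
  exact e ▸ h

/-- The Lie algebra of a closed subgroup `K` of `H`, as a subspace of the Lie algebra of `H`: the
velocities at `1` of the curves in `K` starting at `1`. -/
def subgroupLieAlg (E : Type*) [NormedAddCommGroup E] [NormedSpace ℝ E]
    {H : Type*} [TopologicalSpace H] [ChartedSpace E H] [Group H] [LieGroup 𝓘(ℝ, E) ∞ H]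
    (K : Subgroup H) : Submodule ℝ (LieAlg E H) where
  carrier := {X | ∃ γ : ℝ → H, (∀ t, γ t ∈ K) ∧ γ 0 = 1 ∧
    HasMFDerivAt 𝓘(ℝ, ℝ) 𝓘(ℝ, E) γ 0 (ContinuousLinearMap.toSpanSingleton ℝ (X : E))}
  zero_mem' := by
    refine ⟨fun _ => 1, fun _ => K.one_mem, rfl, ?_⟩
    have h := hasMFDerivAt_const (I := 𝓘(ℝ, ℝ)) (I' := 𝓘(ℝ, E)) (1 : H) (0 : ℝ)
    have e : ContinuousLinearMap.toSpanSingleton ℝ (0 : E) = 0 := by ext; simp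
    exact e ▸ h
  add_mem' := by
    rintro X Y ⟨γ, hγK, hγ0, hγ⟩ ⟨δ, hδK, hδ0, hδ⟩
    refine ⟨fun t => γ t * δ t, fun t => K.mul_mem (hγK t) (hδK t), by simp [hγ0, hδ0], ?_⟩
    have h := HasMFDerivAt.comp (f := fun t => (γ t, δ t)) (0 : ℝ)
      (hasMFDerivAt_mul_of_eq_one (E := E) hγ0 hδ0) (hγ.prodMk hδ)
    have e : (ContinuousLinearMap.fst ℝ E E + ContinuousLinearMap.snd ℝ E E).comp
          ((ContinuousLinearMap.toSpanSingleton ℝ (X : E)).prod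
            (ContinuousLinearMap.toSpanSingleton ℝ (Y : E))) =
        ContinuousLinearMap.toSpanSingleton ℝ ((X : E) + (Y : E)) := by
      refine ContinuousLinearMap.ext fun t => ?_
      exact (smul_add t (X : E) (Y : E)).symm
    exact e ▸ h
  smul_mem' := by
    rintro c X ⟨γ, hγK, hγ0, hγ⟩
    refine ⟨fun t => γ (c * t), fun t => hγK _, by simp [hγ0], ?_⟩
    have h1 : HasMFDerivAt 𝓘(ℝ, ℝ) 𝓘(ℝ, ℝ) (fun t : ℝ => c * t) 0
        (ContinuousLinearMap.toSpanSingleton ℝ c) := by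
      have := ((hasDerivAt_id (0 : ℝ)).const_mul c).hasFDerivAt.hasMFDerivAt
      rw [mul_one] at this
      exact this
    have h2 : HasMFDerivAt 𝓘(ℝ, ℝ) 𝓘(ℝ, E) γ (c * 0)
        (ContinuousLinearMap.toSpanSingleton ℝ (X : E)) := by
      rw [mul_zero]; exact hγ
    have h3 := HasMFDerivAt.comp (0 : ℝ) h2 h1
    have e : (ContinuousLinearMap.toSpanSingleton ℝ (X : E)).comp
        (ContinuousLinearMap.toSpanSingleton ℝ c) =
          ContinuousLinearMap.toSpanSingleton ℝ (c • (X : E)) := by ext; simp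
    exact e ▸ h3

variable [CompleteSpace E]

/-- The Killing form of the Lie algebra of `H`. -/
def kil (E : Type*) [NormedAddCommGroup E] [NormedSpace ℝ E] [CompleteSpace E]
    (H : Type*) [TopologicalSpace H] [ChartedSpace E H] [Group H] [LieGroup 𝓘(ℝ, E) ∞ H] :
    LinearMap.BilinForm ℝ (LieAlg E H) :=
  killingForm ℝ (LieAlg E H)

/-- The subspace `𝔮`: the orthogonal complement of the Lie algebra of `K` in the Lie algebra of `H`
with respect to the Killing form. It is identified with the tangent space of `H/K` at the base
point. -/
def isotropySpace (E : Type*) [NormedAddCommGroup E] [NormedSpace ℝ E] [CompleteSpace E]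
    {H : Type*} [TopologicalSpace H] [ChartedSpace E H] [Group H] [LieGroup 𝓘(ℝ, E) ∞ H]
    (K : Subgroup H) : Submodule ℝ (LieAlg E H) :=
  (kil E H).orthogonal (subgroupLieAlg E K)

/-- `H/K` is an irreducible symmetric space: `K` is closed in `H`, the Lie algebra of `K` is the
fixed point set of an involutive automorphism of the Lie algebra of `H`, and the isotropy
representation `Ad : K → GL(𝔮)` is irreducible. -/
structure IsIrreducibleSymmetric (E : Type*) [NormedAddCommGroup E] [NormedSpace ℝ E]
    [CompleteSpace E]
    {H : Type*} [TopologicalSpace H] [ChartedSpace E H] [Group H] [LieGroup 𝓘(ℝ, E) ∞ H]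
    (K : Subgroup H) : Prop where
  isClosed : IsClosed (K : Set H)
  symmetric : ∃ θ : LieAlg E H ≃ₗ⁅ℝ⁆ LieAlg E H, (∀ X, θ (θ X) = X) ∧
    ∀ X, θ X = X ↔ X ∈ subgroupLieAlg E K
  nontrivial : isotropySpace E K ≠ ⊥
  irreducible : ∀ W : Submodule ℝ (LieAlg E H), W ≤ isotropySpace E K →
    (∀ k ∈ K, ∀ X ∈ W, adjointRep k X ∈ W) → W = ⊥ ∨ W = isotropySpace E K

end LieGroups

/-! ### The homogeneous space `(H × H) / ΔK` and its invariant metrics -/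

section HomogeneousSpace

/-- The diagonal embedding `ΔK = {(k, k) : k ∈ K}` of a subgroup `K ≤ H` in `H × H`. -/
def diagSubgroup {H : Type*} [Group H] (K : Subgroup H) : Subgroup (H × H) :=
  K.map ((MonoidHom.id H).prod (MonoidHom.id H))

/-- The homogeneous space `M = (H × H) / ΔK`. It carries the quotient topology, and `H × H` acts on
it by left translations. -/
abbrev DiagQuotient {H : Type*} [Group H] (K : Subgroup H) : Type _ :=
  (H × H) ⧸ diagSubgroup K

variable {E : Type*} [NormedAddCommGroup E] [NormedSpace ℝ E]
  {H : Type*} [TopologicalSpace H] [ChartedSpace E H] [Group H]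
  {F : Type*} [NormedAddCommGroup F] [NormedSpace ℝ F]
  {K : Subgroup H} [ChartedSpace F (DiagQuotient K)]

/-- The given charts define the standard smooth structure of the homogeneous space
`(H × H) / ΔK`, i.e. the unique one for which the canonical projection from `H × H` is a smooth
submersion. -/
def IsStandardSmoothStructure (E F : Type*) [NormedAddCommGroup E] [NormedSpace ℝ E]
    [NormedAddCommGroup F] [NormedSpace ℝ F]
    {H : Type*} [TopologicalSpace H] [ChartedSpace E H] [Group H]
    (K : Subgroup H) [ChartedSpace F (DiagQuotient K)] : Prop :=
  IsSubmersion (𝓘(ℝ, E).prod 𝓘(ℝ, E)) 𝓘(ℝ, F) ∞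
    (fun a : H × H => (QuotientGroup.mk a : DiagQuotient K))

/-- For `X`, `Y` in the Lie algebra of `H`, the tangent vector at the base point of `(H × H) / ΔK`
which is the image of `(X, Y)` under the differential of the projection. -/
def toTangent (F : Type*) [NormedAddCommGroup F] [NormedSpace ℝ F]
    (K : Subgroup H) [ChartedSpace F (DiagQuotient K)] (X Y : LieAlg E H) :
    TangentSpace 𝓘(ℝ, F) (QuotientGroup.mk (1 : H × H) : DiagQuotient K) :=
  mfderiv (𝓘(ℝ, E).prod 𝓘(ℝ, E)) 𝓘(ℝ, F)
    (fun a : H × H => (QuotientGroup.mk a : DiagQuotient K)) 1 ((X, Y) : E × E)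

variable [IsManifold 𝓘(ℝ, F) ∞ (DiagQuotient K)]

/-- The metric is `H × H`-invariant: every left translation is an isometry. -/
def IsInvariantMetric (g : SmoothMetric F (DiagQuotient K)) : Prop :=
  ∀ (a : H × H) (p : DiagQuotient K) (v w : TangentSpace 𝓘(ℝ, F) p),
    g.inner (a • p)
      (mfderiv 𝓘(ℝ, F) 𝓘(ℝ, F) (fun r : DiagQuotient K => a • r) p v)
      (mfderiv 𝓘(ℝ, F) 𝓘(ℝ, F) (fun r : DiagQuotient K => a • r) p w) = g.inner p v w

variable [CompleteSpace E] [LieGroup 𝓘(ℝ, E) ∞ H]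

/-- The invariant metric `g` is the metric `(x₁, x₂, x₃, x₄)`: its value at the base point is
prescribed, in terms of the Killing form of `𝔥`, on
`𝔭 = 𝔭₁ ⊕ 𝔭₂ ⊕ 𝔭₃`, `𝔭₁ = (𝔮, 0)`, `𝔭₂ = (0, 𝔮)`, `𝔭₃ = {(Z, -Z) : Z ∈ 𝔨}`. -/
structure HasParameters (E : Type*) [NormedAddCommGroup E] [NormedSpace ℝ E] [CompleteSpace E]
    {H : Type*} [TopologicalSpace H] [ChartedSpace E H] [Group H] [LieGroup 𝓘(ℝ, E) ∞ H]
    {F : Type*} [NormedAddCommGroup F] [NormedSpace ℝ F]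
    {K : Subgroup H} [ChartedSpace F (DiagQuotient K)] [IsManifold 𝓘(ℝ, F) ∞ (DiagQuotient K)]
    (g : SmoothMetric F (DiagQuotient K)) (x₁ x₂ x₃ x₄ : ℝ) : Prop where
  invariant : IsInvariantMetric g
  on_p₁₂ : ∀ X₁ ∈ isotropySpace E K, ∀ X₂ ∈ isotropySpace E K,
    ∀ Y₁ ∈ isotropySpace E K, ∀ Y₂ ∈ isotropySpace E K,
    g.inner _ (toTangent F K X₁ X₂) (toTangent F K Y₁ Y₂) =
      x₁ * (-kil E H X₁ Y₁) + x₂ * (-kil E H X₂ Y₂)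
        + x₄ * (-kil E H X₁ Y₂ + -kil E H X₂ Y₁)
  on_p₁₂_p₃ : ∀ X₁ ∈ isotropySpace E K, ∀ X₂ ∈ isotropySpace E K, ∀ Z ∈ subgroupLieAlg E K,
    g.inner _ (toTangent F K X₁ X₂) (toTangent F K Z (-Z)) = 0
  on_p₃ : ∀ Z ∈ subgroupLieAlg E K, ∀ W ∈ subgroupLieAlg E K,
    g.inner _ (toTangent F K Z (-Z)) (toTangent F K W (-W)) = 2 * x₃ * (-kil E H Z W)

end HomogeneousSpace

end

open Filter Topology VectorField

noncomputable section

set_option linter.unusedSectionVars false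

/-! The curvature is computed with a Maurer-Cartan coframe. Near a point, the inverse of the chart
lifts to a smooth map σ into H × H, and η = σ⁻¹dσ takes values in V = 𝔥 ⊕ 𝔥. By invariance the
metric in the chart is β(Pη, Pη), where P is the differential of the projection at the identity and
β is the metric at the base point. The equation dη = -[η, η] then turns the coordinate formulas for
Γ and for the Riemann tensor into algebra on V (`christoffel_metricOf`, `localRiemann_metricOf`).
The connection becomes the Nomizu map Λ given by the Koszul formula, and the curvature becomes
[Λ(X), Λ(Y)] - Λ([X, Y]). Since Λ is defined on all of V and not only on a complement of the
isotropy algebra, no reductive splitting has to be carried along; `curv_congr` shows that the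
curvature descends to the tangent space.

Tracing over an orthonormal frame e_i gives, in the unimodular case (`sum_curv_eq`), with c_ijk =
β(P[e_i, e_j], P e_k), Sc = -¼ Σ c_ijk² + ½ Σ c_kij c_kji - Σ β(P[[e_i, e_j], e_j], P e_i).

For the pair at hand, let B be the opposite of the Killing form. It is positive definite on 𝔨 and on
𝔮, as one reads off from the positivity of g. Choose B-orthonormal bases q_i of 𝔮 and k_a of 𝔨, and
use the frame (v_s q_i, w_s q_i), (r k_a, -r k_a), where the two vectors (v_s, w_s) are orthonormal
for the matrix with rows (x₁, x₄), (x₄, x₂), and 2x₃r² = 1. All nonzero c_ijk are multiples of T_ija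
= B([q_i, q_j], k_a). Thus only two numbers about the symmetric pair enter: Σ T² = n/2 (`sum_T_sq`)
and Σ |[k_a, k_b]|² = d - n/2 (`sum_norm_kk`). Both come from B(x, x) = -tr(ad x)² = Σ |[x, ·]|².
What remains is an identity of rational functions (`sum_cst_eq`). -/

/-- The infinitesimal data of a homogeneous space with an invariant metric: a Lie algebra `V`, the
projection `P` onto the tangent space `F` at the base point, whose kernel is the isotropy algebra,
an inner product `β` on `F` for which the isotropy algebra acts by skew-symmetric operators, and
lifts `e i` of an orthonormal basis of `F`. -/
structure HomogeneousModel (V F ι : Type*) [NormedAddCommGroup V] [NormedSpace ℝ V]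
    [NormedAddCommGroup F] [NormedSpace ℝ F] [Fintype ι] [DecidableEq ι] where
  br : V →L[ℝ] V →L[ℝ] V
  P : V →L[ℝ] F
  β : F →L[ℝ] F →L[ℝ] ℝ
  e : ι → V
  skew : ∀ X Y, br X Y = -br Y X
  jacobi : ∀ X Y Z, br X (br Y Z) = br (br X Y) Z + br Y (br X Z)
  symm : ∀ f f', β f f' = β f' f
  orthonormal : ∀ i j, β (P (e i)) (P (e j)) = if i = j then 1 else 0
  expand : ∀ f, ∑ i, β f (P (e i)) • P (e i) = f
  invariant : ∀ Z, P Z = 0 → ∀ X Y, β (P (br Z X)) (P Y) + β (P X) (P (br Z Y)) = 0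

/-! ### The Nomizu map of a homogeneous model and its curvature -/

namespace HomogeneousModel

variable {V F ι : Type*} [NormedAddCommGroup V] [NormedSpace ℝ V] [NormedAddCommGroup F]
  [NormedSpace ℝ F] [Fintype ι] [DecidableEq ι] (D : HomogeneousModel V F ι)

/-- The degenerate form on the Lie algebra induced by the inner product. -/
def b (X Y : V) : ℝ := D.β (D.P X) (D.P Y)

/-- A linear section of the projection. -/
def lift (f : F) : V := ∑ i, D.β f (D.P (D.e i)) • D.e i

theorem P_lift (f : F) : D.P (D.lift f) = f := by
  simp only [lift, map_sum, map_smul]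
  exact D.expand f

theorem b_add_left (X Y Z : V) : D.b (X + Y) Z = D.b X Z + D.b Y Z := by simp [b]
theorem b_add_right (X Y Z : V) : D.b X (Y + Z) = D.b X Y + D.b X Z := by simp [b]
theorem b_neg_left (X Y : V) : D.b (-X) Y = -D.b X Y := by simp [b]
theorem b_comm (X Y : V) : D.b X Y = D.b Y X := D.symm _ _

theorem b_invariant {Z : V} (hZ : D.P Z = 0) (X Y : V) :
    D.b (D.br Z X) Y = -D.b (D.br Z Y) X := by
  have := D.invariant Z hZ X Y
  rw [D.symm (D.P X)] at this
  exact eq_neg_of_add_eq_zero_left this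

theorem b_ker_right {Z : V} (hZ : D.P Z = 0) (X : V) : D.b X Z = 0 := by simp [b, hZ]

theorem eq_of_beta {f f' : F} (h : ∀ W, D.β f (D.P W) = D.β f' (D.P W)) : f = f' := by
  rw [← D.expand f, ← D.expand f']
  exact Finset.sum_congr rfl fun i _ => by rw [h]

theorem beta_eq_sum (f f' : F) :
    D.β f f' = ∑ i, D.β f (D.P (D.e i)) * D.β f' (D.P (D.e i)) := by
  conv_lhs => rw [← D.expand f']
  simp [mul_comm]

/-- The Koszul expression. -/
def koszul (X Y W : V) : ℝ :=
  1 / 2 * (D.b (D.br X Y) W - D.b (D.br X W) Y - D.b (D.br Y W) X)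

/-- Changing W by an isotropy element Z adds -½(b([X, Z], Y) + b([Y, Z], X)), which vanishes because
ad Z is skew for the form. -/
theorem koszul_congr_right (X Y : V) {W W' : V} (h : D.P W = D.P W') :
    D.koszul X Y W = D.koszul X Y W' := by
  have h0 : D.P (W' - W) = 0 := by rw [map_sub, h, sub_self]
  obtain ⟨Z, rfl⟩ : ∃ Z, W' = W + Z := ⟨W' - W, by abel⟩
  replace h0 : D.P Z = 0 := by simpa using h0
  have h1 := D.b_invariant h0 X Y
  simp only [koszul, map_add, b_add_left, b_add_right, D.b_ker_right h0]
  rw [D.skew X Z, D.skew Y Z, b_neg_left, b_neg_left]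
  linarith

/-- The Koszul expression is antisymmetric in its last two arguments, so this reduces to
independence in the last one. There is no analogue for the first argument: an isotropy element acts
there through the isotropy representation. -/
theorem koszul_congr_mid (X W : V) {Y Y' : V} (h : D.P Y = D.P Y') :
    D.koszul X Y W = D.koszul X Y' W := by
  have := D.koszul_congr_right X W h
  have e : ∀ Y, D.koszul X Y W = -D.koszul X W Y := fun Y => by
    simp only [koszul]
    rw [D.skew W Y, b_neg_left]
    ring
  rw [e, e, this]

section conn

variable [FiniteDimensional ℝ V] [FiniteDimensional ℝ F]

/-- The Levi-Civita connection of the homogeneous space, as a linear map from the Lie algebra to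
the endomorphisms of the tangent space (the Nomizu map). -/
def conn : V →L[ℝ] F →L[ℝ] F :=
  LinearMap.toContinuousBilinearMap <| LinearMap.mk₂ ℝ
    (fun X f => ∑ k, D.koszul X (D.lift f) (D.e k) • D.P (D.e k))
    (fun X X' f => by
      rw [← Finset.sum_add_distrib]
      refine Finset.sum_congr rfl fun k _ => ?_
      rw [← add_smul]
      simp only [koszul, b, map_add, add_apply]
      congr 1; ring)
    (fun c X f => by
      rw [Finset.smul_sum]
      refine Finset.sum_congr rfl fun k _ => ?_
      rw [smul_smul]
      simp only [koszul, b, map_smul, smul_apply, smul_eq_mul]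
      congr 1; ring)
    (fun X f f' => by
      have hl : D.lift (f + f') = D.lift f + D.lift f' := by
        simp [lift, add_smul, Finset.sum_add_distrib]
      rw [← Finset.sum_add_distrib]
      refine Finset.sum_congr rfl fun k _ => ?_
      rw [← add_smul, hl]
      simp only [koszul, b, map_add, add_apply]
      congr 1; ring)
    (fun c X f => by
      have hl : D.lift (c • f) = c • D.lift f := by
        simp [lift, mul_smul, Finset.smul_sum]
      rw [Finset.smul_sum]
      refine Finset.sum_congr rfl fun k _ => ?_
      rw [smul_smul, hl]
      simp only [koszul, b, map_smul, smul_apply, smul_eq_mul]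
      congr 1; ring)

theorem conn_apply (X : V) (f : F) :
    D.conn X f = ∑ k, D.koszul X (D.lift f) (D.e k) • D.P (D.e k) := rfl

theorem beta_conn (X Y W : V) : D.β (D.conn X (D.P Y)) (D.P W) = D.koszul X Y W := by
  have hW : ∀ W, D.P (D.lift (D.P W)) = D.P W := fun W => D.P_lift _
  rw [conn_apply, D.koszul_congr_mid X W (hW Y).symm, D.koszul_congr_right X _ (hW W).symm]
  generalize D.lift (D.P Y) = Y'
  have : D.koszul X Y' (D.lift (D.P W)) =
      ∑ k, D.β (D.P W) (D.P (D.e k)) * D.koszul X Y' (D.e k) := by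
    simp only [koszul, b, lift, map_sum, map_smul, Finset.mul_sum, ← Finset.sum_sub_distrib,
      smul_eq_mul, sum_apply, smul_apply]
    refine Finset.sum_congr rfl fun k _ => by ring
  rw [this, map_sum, sum_apply]
  refine Finset.sum_congr rfl fun k _ => ?_
  rw [map_smul, smul_apply, smul_eq_mul, mul_comm, D.symm (D.P W)]

/-- Metric compatibility of the connection. -/
theorem conn_skew (X : V) (f f' : F) : D.β (D.conn X f) f' + D.β f (D.conn X f') = 0 := by
  rw [← D.P_lift f, ← D.P_lift f', D.symm (D.P (D.lift f)), beta_conn, beta_conn]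
  simp only [koszul]
  rw [D.skew (D.lift f') (D.lift f), b_neg_left]
  ring

/-- Vanishing of the torsion. -/
theorem conn_sub (X Y : V) : D.conn X (D.P Y) - D.conn Y (D.P X) = D.P (D.br X Y) := by
  refine D.eq_of_beta fun W => ?_
  rw [map_sub, sub_apply, beta_conn, beta_conn]
  simp only [koszul]
  rw [D.skew Y X, b_neg_left]
  simp only [b]
  ring

theorem conn_ker {Z : V} (hZ : D.P Z = 0) (Y : V) : D.conn Z (D.P Y) = D.P (D.br Z Y) := by
  have := D.conn_sub Z Y
  rwa [hZ, map_zero, sub_zero] at this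

/-- The Koszul formula is built from the bracket and the form. The isotropy element Z respects the
first by the Jacobi identity and the second by skewness, so it commutes with the construction. -/
theorem conn_equivariant {Z : V} (hZ : D.P Z = 0) (X : V) (f : F) :
    D.conn (D.br Z X) f = D.conn Z (D.conn X f) - D.conn X (D.conn Z f) := by
  rw [← D.P_lift f]
  generalize D.lift f = Y
  refine D.eq_of_beta fun W => ?_
  rw [map_sub, sub_apply, eq_neg_of_add_eq_zero_left (D.conn_skew Z _ _), D.conn_ker hZ,
    D.conn_ker hZ, beta_conn, beta_conn, beta_conn]
  simp only [koszul]
  have j := fun Y => D.jacobi Z X Y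
  have h1 := D.b_invariant hZ (D.br X Y) W
  have h2 := D.b_invariant hZ (D.br X W) Y
  have h3 := D.b_invariant hZ (D.br Y W) X
  rw [D.jacobi, b_add_left] at h1 h2 h3
  rw [D.b_comm (D.br Y W) (D.br Z X), D.b_comm (D.br X Y) (D.br Z W),
    D.b_comm (D.br X W) (D.br Z Y)]
  linarith

/-- The curvature, as a bilinear map on the Lie algebra with values in the endomorphisms of the
tangent space. -/
def curv (X Y : V) (f : F) : F :=
  D.conn X (D.conn Y f) - D.conn Y (D.conn X f) - D.conn (D.br X Y) f

/-- For Z in the isotropy algebra the curvature of (Z, Y) is [Λ(Z), Λ(Y)] - Λ([Z, Y]), which is zero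
by `conn_equivariant`. Hence the curvature is a tensor on the tangent space. -/
theorem curv_congr {X X' Y Y' : V} (hX : D.P X = D.P X') (hY : D.P Y = D.P Y') (f : F) :
    D.curv X Y f = D.curv X' Y' f := by
  have key : ∀ {X X' Y : V}, D.P X = D.P X' → D.curv X Y f = D.curv X' Y f := by
    intro X X' Y h
    obtain ⟨Z, rfl⟩ : ∃ Z, X' = X + Z := ⟨X' - X, by abel⟩
    have hZ : D.P Z = 0 := by simpa using h
    simp only [curv, map_add, add_apply]
    rw [D.conn_equivariant hZ]
    abel
  have sw : ∀ X Y, D.curv X Y f = -D.curv Y X f := fun X Y => by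
    simp only [curv]
    rw [D.skew X Y]
    simp only [map_neg, neg_apply]
    abel
  rw [key hX, sw, key hY, ← sw]

end conn

end HomogeneousModel

/-! ### Scalar curvature as a trace over an orthonormal frame -/

theorem isInvertible_of_ker_eq_bot {F : Type*} [NormedAddCommGroup F] [NormedSpace ℝ F]
    [FiniteDimensional ℝ F] (B : F →L[ℝ] F →L[ℝ] ℝ) (hB : ∀ f, B f = 0 → f = 0) :
    B.IsInvertible := by
  have e : Module.finrank ℝ F = Module.finrank ℝ (F →L[ℝ] ℝ) := by
    rw [← (LinearMap.toContinuousLinearMap (𝕜 := ℝ) (E := F) (F' := ℝ)).finrank_eq]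
    exact (Subspace.dual_finrank_eq (K := ℝ) (V := F)).symm
  have hinj : Function.Injective (B : F →ₗ[ℝ] F →L[ℝ] ℝ) :=
    (injective_iff_map_eq_zero _).2 fun f hf => hB f hf
  refine ⟨(LinearEquiv.ofInjectiveOfFinrankEq (B : F →ₗ[ℝ] F →L[ℝ] ℝ) hinj
    e).toContinuousLinearEquiv, ?_⟩
  ext v w
  rfl

section Traces

variable {F ι : Type*} [NormedAddCommGroup F] [NormedSpace ℝ F] [FiniteDimensional ℝ F]
  [Fintype ι] [DecidableEq ι]

/-- The trace of an endomorphism, in an orthonormal basis of a bilinear form. -/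
theorem trace_eq_sum_of_orthonormal (B : F →L[ℝ] F →L[ℝ] ℝ) (f : ι → F)
    (hf : ∀ i j, B (f i) (f j) = if i = j then 1 else 0) (hexp : ∀ v, ∑ i, B v (f i) • f i = v)
    (T : F →ₗ[ℝ] F) :
    ∑ i, (Module.finBasis ℝ F).coord i (T (Module.finBasis ℝ F i)) = ∑ i, B (T (f i)) (f i) := by
  classical
  have hli : LinearIndependent ℝ f := by
    rw [Fintype.linearIndependent_iff]
    intro g hg i
    have := congrArg (fun v => B v (f i)) hg
    simpa [hf] using this
  have hsp : ⊤ ≤ Submodule.span ℝ (Set.range f) := fun v _ => by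
    rw [← hexp v]
    exact Submodule.sum_mem _ fun i _ => Submodule.smul_mem _ _ (Submodule.subset_span ⟨i, rfl⟩)
  let bs := Module.Basis.mk hli hsp
  have hbs : ∀ i, bs i = f i := fun i => Module.Basis.mk_apply hli hsp i
  have hco : ∀ v i, bs.repr v i = B v (f i) := fun v i => by
    have : v = ∑ i, B v (f i) • bs i := by simp only [hbs, hexp]
    conv_lhs => rw [this]
    rw [Module.Basis.repr_sum_self]
  trans LinearMap.trace ℝ F T
  · rw [LinearMap.trace_eq_matrix_trace ℝ (Module.finBasis ℝ F)]
    simp [Matrix.trace, LinearMap.toMatrix_apply]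
  · rw [LinearMap.trace_eq_matrix_trace ℝ bs]
    simp [Matrix.trace, LinearMap.toMatrix_apply, hco, hbs]

/-- In an orthonormal frame the inverse metric is G^{ij} = Σ_k f_k^i f_k^j, so the double
contraction with Ric collapses to Σ_k Ric(f_k, f_k). The map `R` supplies the trilinearity, which
the coordinate formula for the Riemann tensor does not display. -/
theorem localScalar_eq_sum (G : F → F →L[ℝ] F →L[ℝ] ℝ) (u : F) (f : ι → F)
    (hsymm : ∀ v w, G u v w = G u w v)
    (hf : ∀ i j, G u (f i) (f j) = if i = j then 1 else 0) (hexp : ∀ v, ∑ i, G u v (f i) • f i = v)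
    (R : F →ₗ[ℝ] F →ₗ[ℝ] F →ₗ[ℝ] F) (hR : ∀ v w z, localRiemann G u v w z = R v w z) :
    localScalar G u = ∑ j, ∑ i, G u (R (f i) (f j) (f j)) (f i) := by
  have hric : ∀ w z, localRicci G u w z = ∑ i, G u (R (f i) w z) (f i) := fun w z => by
    have := trace_eq_sum_of_orthonormal (G u) f hf hexp
      ((LinearMap.applyₗ z).comp ((LinearMap.applyₗ w).comp R))
    simpa only [localRicci, hR, LinearMap.comp_apply, LinearMap.applyₗ_apply_apply] using this
  have hinv : (G u).IsInvertible := isInvertible_of_ker_eq_bot _ fun v hv => by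
    rw [← hexp v, hv]; simp
  have hi : ∀ φ : F →L[ℝ] ℝ, (G u).inverse φ = ∑ k, φ (f k) • f k := fun φ => by
    have : G u (∑ k, φ (f k) • f k) = φ := by
      ext v
      conv_rhs => rw [← hexp v]
      simp only [map_sum, map_smul, sum_apply, smul_apply, smul_eq_mul]
      exact Finset.sum_congr rfl fun k _ => by rw [hsymm v]; ring
    conv_lhs => rw [← this]
    obtain ⟨e, he⟩ := hinv
    rw [← he]
    simp
  let Ric : F →ₗ[ℝ] F →ₗ[ℝ] ℝ :=
    ∑ i, (R (f i)).compr₂ ((G u).flip (f i) : F →ₗ[ℝ] ℝ)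
  have hRic : ∀ w z, localRicci G u w z = Ric w z := fun w z => by
    simp [hric, Ric, LinearMap.sum_apply]
  set c := Module.finBasis ℝ F with hc
  have hsum : ∀ k, ∑ i, ∑ j, c.coord j (f k) * c.coord i (f k) * Ric (c i) (c j) =
      Ric (f k) (f k) := fun k => by
    have e1 : f k = ∑ i, c.coord i (f k) • c i := (c.sum_repr (f k)).symm
    conv_rhs => rw [e1]
    simp only [map_sum, LinearMap.sum_apply, map_smul, LinearMap.smul_apply, smul_eq_mul,
      Finset.mul_sum]
    rw [Finset.sum_comm]
    exact Finset.sum_congr rfl fun i _ => Finset.sum_congr rfl fun j _ => by ring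
  simp only [localScalar, inverseMetric, hi, ← hc, hRic]
  simp only [← hric, hRic, ← hsum]
  simp only [LinearMap.coe_toContinuousLinearMap', map_sum, map_smul, smul_eq_mul, Finset.sum_mul]
  rw [Finset.sum_comm' (t' := Finset.univ) (s' := fun _ => Finset.univ) (by simp)]
  conv_rhs => rw [Finset.sum_comm]
  conv_lhs => rw [Finset.sum_comm]
  refine Finset.sum_congr rfl fun i _ => ?_
  rw [Finset.sum_comm]

end Traces

/-! ### From a Maurer-Cartan coframe to the curvature in coordinates -/

namespace HomogeneousModel

variable {V F ι : Type*} [NormedAddCommGroup V] [NormedSpace ℝ V] [NormedAddCommGroup F]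
  [NormedSpace ℝ F] [Fintype ι] [DecidableEq ι] (D : HomogeneousModel V F ι)

/-- The metric on `F` whose expression in the coframe `P ∘ η` is `β`. -/
def metricOf (η : F → F →L[ℝ] V) (u : F) : F →L[ℝ] F →L[ℝ] ℝ :=
  D.β.bilinearComp (D.P ∘L η u) (D.P ∘L η u)

theorem metricOf_apply (η : F → F →L[ℝ] V) (u v w : F) :
    D.metricOf η u v w = D.b (η u v) (η u w) := rfl

theorem fderiv_metricOf {η : F → F →L[ℝ] V} {u : F} (hη : DifferentiableAt ℝ η u) (y v w : F) :
    fderiv ℝ (D.metricOf η) u y v w =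
      D.b (fderiv ℝ η u y v) (η u w) + D.b (η u v) (fderiv ℝ η u y w) := by
  have hd : DifferentiableAt ℝ (D.metricOf η) u := by
    have hd1 : DifferentiableAt ℝ (fun u => D.P ∘L η u) u :=
      (differentiableAt_const _).clm_comp hη
    have hd2 : DifferentiableAt ℝ (fun u =>
        (ContinuousLinearMap.compL ℝ F F ℝ).flip (D.P ∘L η u)) u :=
      DifferentiableAt.comp (g := fun A => (ContinuousLinearMap.compL ℝ F F ℝ).flip A)
        (f := fun u => D.P ∘L η u) u (by fun_prop) hd1
    exact hd2.clm_comp ((differentiableAt_const D.β).clm_comp hd1)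
  have h1 := ((hd.hasFDerivAt.clm_apply (hasFDerivAt_const v u)).clm_apply (hasFDerivAt_const w u))
  have h2 : HasFDerivAt (fun u => D.β (D.P (η u v)) (D.P (η u w))) _ u :=
    ((D.β ∘L D.P).hasFDerivAt.comp u
        (hη.hasFDerivAt.clm_apply (hasFDerivAt_const v u))).clm_apply
      (D.P.hasFDerivAt.comp u (hη.hasFDerivAt.clm_apply (hasFDerivAt_const w u)))
  have := congrArg (fun A => A y) (h1.unique h2)
  simpa [b, add_comm] using this

theorem isInvertible_metricOf [FiniteDimensional ℝ F] {η : F → F →L[ℝ] V} {u : F} (hθ : (D.P ∘L η u).IsInvertible) :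
    (D.metricOf η u).IsInvertible := by
  obtain ⟨θ, hθ⟩ := hθ
  have hθ' : ∀ v, D.P (η u v) = θ v := fun v => (congrArg (fun A => A v) hθ).symm
  refine isInvertible_of_ker_eq_bot _ fun f hf => ?_
  refine θ.map_eq_zero_iff.1 (D.eq_of_beta fun W => ?_)
  have := congrArg (fun A => A (θ.symm (D.P W))) hf
  simpa [metricOf_apply, b, hθ'] using this

variable [FiniteDimensional ℝ V] [FiniteDimensional ℝ F]

/-- The Levi-Civita connection in terms of the Maurer-Cartan form. -/
theorem christoffel_metricOf {η : F → F →L[ℝ] V} {u : F} (hη : DifferentiableAt ℝ η u)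
    (hMC : ∀ v w, fderiv ℝ η u v w - fderiv ℝ η u w v = -D.br (η u v) (η u w))
    (hθ : (D.P ∘L η u).IsInvertible) (v w : F) :
    D.P (η u (christoffel (D.metricOf η) u v w)) =
      D.P (fderiv ℝ η u v w) + D.conn (η u v) (D.P (η u w)) := by
  have hinv := D.isInvertible_metricOf hθ
  obtain ⟨θ, hθ⟩ := hθ
  have hθ' : ∀ v, D.P (η u v) = θ v := fun v => (congrArg (fun A => A v) hθ).symm
  set q := D.P (fderiv ℝ η u v w) + D.conn (η u v) (D.P (η u w)) with hq
  -- The candidate is tested against each y. Once the Maurer-Cartan equation replaces the brackets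
  -- in the Koszul formula by antisymmetrised derivatives of η, both sides are the same combination
  -- of terms b(∂η, η).
  have key : D.metricOf η u (θ.symm q) = christoffelLower (D.metricOf η) u v w := by
    ext y
    rw [christoffelLower_apply, metricOf_apply, D.fderiv_metricOf hη, D.fderiv_metricOf hη,
      D.fderiv_metricOf hη]
    simp only [b, hθ', ContinuousLinearEquiv.apply_symm_apply, hq, map_add, add_apply]
    simp only [← hθ']
    rw [beta_conn, koszul]
    have m1 := hMC v w
    have m2 := hMC v y
    have m3 := hMC w y
    have e1 : D.br (η u v) (η u w) = fderiv ℝ η u w v - fderiv ℝ η u v w := by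
      rw [← neg_inj, ← m1]; abel
    have e2 : D.br (η u v) (η u y) = fderiv ℝ η u y v - fderiv ℝ η u v y := by
      rw [← neg_inj, ← m2]; abel
    have e3 : D.br (η u w) (η u y) = fderiv ℝ η u y w - fderiv ℝ η u w y := by
      rw [← neg_inj, ← m3]; abel
    rw [e1, e2, e3]
    simp only [b, map_sub, sub_apply]
    rw [D.symm (D.P (η u w)) (D.P (fderiv ℝ η u v y)), D.symm (D.P (η u v))
      (D.P (fderiv ℝ η u w y)), D.symm (D.P (η u v)) (D.P (fderiv ℝ η u y w))]
    ring
  have : christoffel (D.metricOf η) u v w = θ.symm q := by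
    rw [christoffel, ← key]
    obtain ⟨e, he⟩ := hinv
    rw [← he]
    simp
  rw [this, hθ', ContinuousLinearEquiv.apply_symm_apply]

/-- In the trivialisation Pη the covariant derivative is ∂ + Λ(η), with curvature [Λ(η v), Λ(η w)] +
Λ(dη(v, w)); the Maurer-Cartan equation turns the last term into -Λ([η v, η w]). -/
theorem localRiemann_metricOf {η : F → F →L[ℝ] V} {u : F} (hη : ContDiffAt ℝ 2 η u)
    (hMC : ∀ᶠ x in 𝓝 u, ∀ v w, fderiv ℝ η x v w - fderiv ℝ η x w v = -D.br (η x v) (η x w))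
    (hθ : ∀ᶠ x in 𝓝 u, (D.P ∘L η x).IsInvertible) (v w z : F) :
    D.P (η u (localRiemann (D.metricOf η) u v w z)) =
      D.curv (η u v) (η u w) (D.P (η u z)) := by
  have hd : ∀ᶠ x in 𝓝 u, DifferentiableAt ℝ η x := by
    filter_upwards [hη.eventually (by simp)] with x hx using hx.differentiableAt (by simp)
  have hη1 : DifferentiableAt ℝ η u := hd.self_of_nhds
  have hη2 : DifferentiableAt ℝ (fderiv ℝ η) u :=
    (hη.fderiv_right (m := 1) (by norm_num)).differentiableAt (by simp)
  set Γ := fun w z x => christoffel (D.metricOf η) x w z with hΓ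
  have hform : ∀ w z, ∀ᶠ x in 𝓝 u, D.P (η x (Γ w z x)) =
      D.P (fderiv ℝ η x w z) + D.conn (η x w) (D.P (η x z)) := fun w z => by
    filter_upwards [hd, hMC, hθ] with x h1 h2 h3 using D.christoffel_metricOf h1 h2 h3 w z
  have hev : ∀ w, HasFDerivAt (fun x => η x w) ((fderiv ℝ η u).flip w) u := fun w => by
    simpa using hη1.hasFDerivAt.clm_apply (hasFDerivAt_const w u)
  have hq : ∀ w z, HasFDerivAt
      (fun x => D.P (fderiv ℝ η x w z) + D.conn (η x w) (D.P (η x z)))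
      (D.P ∘L ((fderiv ℝ (fderiv ℝ η) u).flip w).flip z +
        ((D.conn (η u w)) ∘L (D.P ∘L (fderiv ℝ η u).flip z) +
          (D.conn ∘L (fderiv ℝ η u).flip w).flip (D.P (η u z)))) u := fun w z => by
    refine HasFDerivAt.add ?_ ?_
    · refine D.P.hasFDerivAt.comp u ?_
      simpa using (hη2.hasFDerivAt.clm_apply (hasFDerivAt_const w u)).clm_apply
        (hasFDerivAt_const z u)
    · exact (D.conn.hasFDerivAt.comp u (hev w)).clm_apply (D.P.hasFDerivAt.comp u (hev z))
  -- Differentiability of Γ is obtained by solving the formula for PηΓ, since inversion of operators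
  -- is smooth.
  have hΓd : ∀ w z, DifferentiableAt ℝ (Γ w z) u := fun w z => by
    have h1 : Γ w z =ᶠ[𝓝 u] fun x => (D.P ∘L η x).inverse
        (D.P (fderiv ℝ η x w z) + D.conn (η x w) (D.P (η x z))) := by
      filter_upwards [hform w z, hθ] with x h1 h2
      rw [← h1]
      obtain ⟨e, he⟩ := h2
      change _ = (D.P ∘L η x).inverse ((D.P ∘L η x) (Γ w z x))
      rw [← he]
      simp
    refine DifferentiableAt.congr_of_eventuallyEq ?_ h1
    have h2 : DifferentiableAt ℝ (fun x => (D.P ∘L η x).inverse) u :=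
      DifferentiableAt.comp (g := ContinuousLinearMap.inverse) (f := fun x => D.P ∘L η x) u
        ((hθ.self_of_nhds.contDiffAt_map_inverse (n := 1)).differentiableAt (by simp))
        ((differentiableAt_const _).clm_comp hη1)
    exact h2.clm_apply (hq w z).differentiableAt
  -- This is ∇_v ∇_w z read in the coframe. On the right, only the Λ(∂_v η(w)) term and the ΛΛ term
  -- survive antisymmetrisation in v and w: the two mixed terms exchange places and the second
  -- derivative of η is symmetric.
  have hcov : ∀ v w z, D.P (η u (fderiv ℝ (Γ w z) u v + Γ v (Γ w z u) u)) =
      D.P (fderiv ℝ (fderiv ℝ η) u v w z) + D.conn (fderiv ℝ η u v w) (D.P (η u z)) +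
        D.conn (η u w) (D.P (fderiv ℝ η u v z)) + D.conn (η u v) (D.P (fderiv ℝ η u w z)) +
        D.conn (η u v) (D.conn (η u w) (D.P (η u z))) := fun v w z => by
    have h1 := D.P.hasFDerivAt.comp u (hη1.hasFDerivAt.clm_apply (hΓd w z).hasFDerivAt)
    have h2 := congrArg (fun A => A v) (h1.unique ((hq w z).congr_of_eventuallyEq (hform w z)))
    have h3 := (hform v (Γ w z u)).self_of_nhds
    have h4 := (hform w z).self_of_nhds
    simp only [ContinuousLinearMap.comp_apply, add_apply, ContinuousLinearMap.flip_apply, map_add]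
      at h2
    rw [map_add, map_add, h3, h4, map_add, eq_sub_of_add_eq h2]
    abel
  have hsymm : ∀ v w, fderiv ℝ (fderiv ℝ η) u v w = fderiv ℝ (fderiv ℝ η) u w v := fun v w =>
    hη.isSymmSndFDerivAt (by simp) v w
  have e : localRiemann (D.metricOf η) u v w z = (fderiv ℝ (Γ w z) u v + Γ v (Γ w z u) u) -
      (fderiv ℝ (Γ v z) u w + Γ w (Γ v z u) u) := by
    simp only [localRiemann, hΓ]
    abel
  rw [e, map_sub, map_sub, hcov, hcov, hsymm v w, curv]
  have m := hMC.self_of_nhds v w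
  rw [← neg_neg (D.br (η u v) (η u w)), ← m]
  simp only [map_neg, map_sub, neg_apply, sub_apply]
  abel

end HomogeneousModel

theorem localScalar_congr {F : Type*} [NormedAddCommGroup F] [NormedSpace ℝ F]
    [FiniteDimensional ℝ F] {G G' : F → F →L[ℝ] F →L[ℝ] ℝ} {u : F} (h : G =ᶠ[𝓝 u] G') :
    localScalar G u = localScalar G' u := by
  have h1 : ∀ᶠ x in 𝓝 u, ∀ v w, christoffel G x v w = christoffel G' x v w := by
    filter_upwards [h, h.fderiv (𝕜 := ℝ)] with x h1 h2 v w
    simp only [christoffel, christoffelLower, h1, h2]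
  have h2 : ∀ v w z, localRiemann G u v w z = localRiemann G' u v w z := fun v w z => by
    have e : ∀ w z, (fun x => christoffel G x w z) =ᶠ[𝓝 u] fun x => christoffel G' x w z :=
      fun w z => h1.mono fun x hx => hx w z
    simp only [localRiemann, (e _ _).fderiv_eq, h1.self_of_nhds]
  simp only [localScalar, localRicci, inverseMetric, h2, h.self_of_nhds]

/-- The scalar curvature of a metric which, in the coframe given by a Maurer-Cartan form, is the
inner product of a homogeneous model. -/
theorem HomogeneousModel.localScalar_metricOf {V F ι : Type*} [NormedAddCommGroup V]
    [NormedSpace ℝ V] [NormedAddCommGroup F] [NormedSpace ℝ F] [Fintype ι] [DecidableEq ι]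
    (D : HomogeneousModel V F ι) [FiniteDimensional ℝ V] [FiniteDimensional ℝ F]
    {η : F → F →L[ℝ] V} {u : F} (hη : ContDiffAt ℝ 2 η u)
    (hMC : ∀ᶠ x in 𝓝 u, ∀ v w, fderiv ℝ η x v w - fderiv ℝ η x w v = -D.br (η x v) (η x w))
    (hθ : ∀ᶠ x in 𝓝 u, (D.P ∘L η x).IsInvertible) :
    localScalar (D.metricOf η) u =
      ∑ j, ∑ i, D.β (D.curv (D.e i) (D.e j) (D.P (D.e j))) (D.P (D.e i)) := by
  obtain ⟨θ, hθu⟩ := hθ.self_of_nhds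
  have hθ' : ∀ v, D.P (η u v) = θ v := fun v => (congrArg (fun A => A v) hθu).symm
  have hb : ∀ v w, D.metricOf η u v w = D.β (θ v) (θ w) := fun v w => by
    rw [D.metricOf_apply, HomogeneousModel.b, hθ', hθ']
  have hfi : ∀ i, θ (θ.symm (D.P (D.e i))) = D.P (D.e i) := fun i => θ.apply_symm_apply _
  let R : F →ₗ[ℝ] F →ₗ[ℝ] F →ₗ[ℝ] F := LinearMap.mk₂ ℝ
    (fun v w =>
      { toFun := fun z => θ.symm (D.curv (η u v) (η u w) (θ z))
        map_add' := fun z z' => by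
          simp only [HomogeneousModel.curv, map_add, map_sub]; abel
        map_smul' := fun c z => by
          simp only [HomogeneousModel.curv, map_smul, map_sub, smul_sub, RingHom.id_apply] })
    (fun v v' w => by
      ext z
      simp only [HomogeneousModel.curv, map_add, map_sub, add_apply, LinearMap.add_apply,
        LinearMap.coe_mk, AddHom.coe_mk]
      abel)
    (fun c v w => by
      ext z
      simp only [HomogeneousModel.curv, map_smul, map_sub, smul_apply, LinearMap.smul_apply,
        LinearMap.coe_mk, AddHom.coe_mk, smul_sub])
    (fun v w w' => by
      ext z
      simp only [HomogeneousModel.curv, map_add, map_sub, add_apply, LinearMap.add_apply,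
        LinearMap.coe_mk, AddHom.coe_mk]
      abel)
    (fun c v w => by
      ext z
      simp only [HomogeneousModel.curv, map_smul, map_sub, smul_apply, LinearMap.smul_apply,
        LinearMap.coe_mk, AddHom.coe_mk, smul_sub])
  rw [localScalar_eq_sum (D.metricOf η) u (fun i => θ.symm (D.P (D.e i)))
    (fun v w => by rw [hb, hb, D.symm]) (fun i j => by rw [hb, hfi, hfi, D.orthonormal])
    (fun v => ?_) R (fun v w z => ?_)]
  · refine Finset.sum_congr rfl fun j _ => Finset.sum_congr rfl fun i _ => ?_
    rw [hb, hfi]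
    congr 1
    change D.β (θ (θ.symm (D.curv _ _ (θ (θ.symm _))))) = _
    rw [θ.apply_symm_apply, θ.apply_symm_apply]
    congr 1
    exact D.curv_congr (by rw [hθ', hfi]) (by rw [hθ', hfi]) _
  · simp only [hb, hfi]
    apply θ.injective
    simp only [map_sum, map_smul, hfi, D.expand]
  · change _ = θ.symm (D.curv (η u v) (η u w) (θ z))
    rw [θ.eq_symm_apply, ← hθ', D.localRiemann_metricOf hη hMC hθ, hθ']

/-! ### Scalar curvature in terms of structure constants -/

namespace HomogeneousModel

variable {V F ι : Type*} [NormedAddCommGroup V] [NormedSpace ℝ V] [NormedAddCommGroup F]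
  [NormedSpace ℝ F] [Fintype ι] [DecidableEq ι] (D : HomogeneousModel V F ι)

/-- The structure constants of a homogeneous model. -/
def sc (i j k : ι) : ℝ := D.b (D.br (D.e i) (D.e j)) (D.e k)

theorem sc_swap (i j k : ι) : D.sc j i k = -D.sc i j k := by
  rw [sc, D.skew, b_neg_left, sc]

theorem b_eq_sum (X Y : V) : D.b X Y = ∑ k, D.b X (D.e k) * D.b Y (D.e k) := D.beta_eq_sum _ _

theorem koszul_e (i j k : ι) : D.koszul (D.e i) (D.e j) (D.e k) =
    1 / 2 * (D.sc i j k - D.sc i k j - D.sc j k i) := rfl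

/-- The scalar curvature of a unimodular homogeneous space in terms of the structure constants. -/
theorem sum_curv_eq [FiniteDimensional ℝ V] [FiniteDimensional ℝ F]
    (huni : ∀ k, ∑ j, D.sc j k j = 0) :
    ∑ j, ∑ i, D.β (D.curv (D.e i) (D.e j) (D.P (D.e j))) (D.P (D.e i)) =
      -(1 / 4) * ∑ i, ∑ j, ∑ k, D.sc i j k ^ 2 + 1 / 2 * ∑ i, ∑ j, ∑ k, D.sc k i j * D.sc k j i
        - ∑ i, ∑ j, D.b (D.br (D.br (D.e i) (D.e j)) (D.e j)) (D.e i) := by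
  have hself : ∀ i k, D.sc i i k = 0 := fun i k => by have := D.sc_swap i i k; linarith
  -- Skewness of Λ moves the outer operator to the other side of β, after which the inner product is
  -- expanded in the frame.
  have hpt : ∀ i j, D.β (D.curv (D.e i) (D.e j) (D.P (D.e j))) (D.P (D.e i)) =
      -(∑ k, D.koszul (D.e j) (D.e j) (D.e k) * D.koszul (D.e i) (D.e i) (D.e k)) +
      ∑ k, D.koszul (D.e i) (D.e j) (D.e k) * D.koszul (D.e j) (D.e i) (D.e k) -
      D.koszul (D.br (D.e i) (D.e j)) (D.e j) (D.e i) := fun i j => by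
    simp only [curv, map_sub, sub_apply, beta_conn]
    rw [eq_neg_of_add_eq_zero_left (D.conn_skew (D.e i) (D.conn (D.e j) _) _),
      eq_neg_of_add_eq_zero_left (D.conn_skew (D.e j) (D.conn (D.e i) _) _),
      D.beta_eq_sum (D.conn (D.e j) (D.P (D.e j))), D.beta_eq_sum (D.conn (D.e i) (D.P (D.e j)))]
    simp only [beta_conn]
    ring
  -- Here unimodularity enters: it says that Σ_j Λ(e_j)e_j = 0.
  have h1 : ∑ j, ∑ i, ∑ k, D.koszul (D.e j) (D.e j) (D.e k) * D.koszul (D.e i) (D.e i) (D.e k)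
      = 0 := by
    have h0 : ∀ k, ∑ j, D.koszul (D.e j) (D.e j) (D.e k) = 0 := fun k => by
      have : ∀ j, D.koszul (D.e j) (D.e j) (D.e k) = -D.sc j k j := fun j => by
        rw [koszul_e, hself]; ring
      simp only [this, Finset.sum_neg_distrib, huni, neg_zero]
    have : ∀ j, ∑ i, ∑ k, D.koszul (D.e j) (D.e j) (D.e k) * D.koszul (D.e i) (D.e i) (D.e k)
        = 0 := fun j => by
      rw [Finset.sum_comm]
      simp only [← Finset.mul_sum, h0, mul_zero, Finset.sum_const_zero]
    simp only [this, Finset.sum_const_zero]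
  set A := ∑ i, ∑ j, ∑ k, D.sc i j k ^ 2 with hA
  set C := ∑ i, ∑ j, ∑ k, D.sc k i j * D.sc k j i with hC
  set Q := ∑ i, ∑ j, D.b (D.br (D.br (D.e i) (D.e j)) (D.e j)) (D.e i) with hQ
  have rot : ∀ f : ι → ι → ι → ℝ, ∑ i, ∑ j, ∑ k, f j k i = ∑ i, ∑ j, ∑ k, f i j k := fun f => by
    rw [Finset.sum_comm]
    exact Finset.sum_congr rfl fun j _ => Finset.sum_comm
  have sw : ∀ f : ι → ι → ι → ℝ, ∑ i, ∑ j, ∑ k, f i k j = ∑ i, ∑ j, ∑ k, f i j k := fun f =>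
    Finset.sum_congr rfl fun j _ => Finset.sum_comm
  have h2 : ∑ j, ∑ i, ∑ k, D.koszul (D.e i) (D.e j) (D.e k) * D.koszul (D.e j) (D.e i) (D.e k)
      = 1 / 4 * A + 1 / 2 * C := by
    have e : ∀ j i k, D.koszul (D.e i) (D.e j) (D.e k) * D.koszul (D.e j) (D.e i) (D.e k) =
        1 / 4 * D.sc i k j ^ 2 + 1 / 4 * D.sc j k i ^ 2 + 1 / 2 * (D.sc k i j * D.sc k j i)
          - 1 / 4 * D.sc j i k ^ 2 := fun j i k => by
      rw [koszul_e, koszul_e, D.sc_swap j i, D.sc_swap i k, D.sc_swap j k]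
      ring
    simp only [e, Finset.sum_add_distrib, Finset.sum_sub_distrib, ← Finset.mul_sum]
    rw [rot (fun i k j => D.sc i k j ^ 2), sw (fun j i k => D.sc j i k ^ 2),
      Finset.sum_comm (f := fun j i => ∑ k, D.sc k i j * D.sc k j i)]
    ring
  have h3 : ∑ j, ∑ i, D.koszul (D.br (D.e i) (D.e j)) (D.e j) (D.e i) = Q + 1 / 2 * A := by
    have e : ∀ j i, D.koszul (D.br (D.e i) (D.e j)) (D.e j) (D.e i) =
        1 / 2 * D.b (D.br (D.br (D.e i) (D.e j)) (D.e j)) (D.e i) +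
        1 / 2 * D.b (D.br (D.br (D.e j) (D.e i)) (D.e i)) (D.e j) +
        1 / 2 * ∑ k, D.sc i j k ^ 2 := fun j i => by
      have : D.b (D.br (D.e i) (D.e j)) (D.br (D.e i) (D.e j)) = ∑ k, D.sc i j k ^ 2 := by
        rw [b_eq_sum]
        exact Finset.sum_congr rfl fun k _ => by rw [sc]; ring
      rw [koszul, D.skew (D.e j) (D.e i), b_neg_left, this, map_neg, neg_apply, b_neg_left]
      ring
    simp only [e, Finset.sum_add_distrib, ← Finset.mul_sum]
    rw [Finset.sum_comm (f := fun j i => D.b (D.br (D.br (D.e i) (D.e j)) (D.e j)) (D.e i)),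
      Finset.sum_comm (f := fun j i => ∑ k, D.sc i j k ^ 2)]
    ring
  simp only [hpt, Finset.sum_add_distrib, Finset.sum_sub_distrib, Finset.sum_neg_distrib, h1, h2,
    h3]
  ring

end HomogeneousModel

/-- The sum giving the scalar curvature, for structure constants in block form. -/
theorem sum_structureConstants {α κ : Type*} [Fintype α] [Fintype κ]
    (c : (Fin 2 × α) ⊕ κ → (Fin 2 × α) ⊕ κ → (Fin 2 × α) ⊕ κ → ℝ)
    (Q : (Fin 2 × α) ⊕ κ → (Fin 2 × α) ⊕ κ → ℝ)
    (T : α → α → κ → ℝ) (S : κ → ℝ) (N r : ℝ) (w m μ : Fin 2 → Fin 2 → ℝ) (ν : Fin 2 → ℝ)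
    (hT : ∀ i j a, T j i a = -T i j a) (hN : ∑ i, ∑ j, ∑ a, T i j a ^ 2 = N)
    (hqqq : ∀ i j k, c (.inl i) (.inl j) (.inl k) = 0)
    (hqqk : ∀ s i t j a, c (.inl (s, i)) (.inl (t, j)) (.inr a) = w s t * T i j a)
    (hkqq : ∀ a s i t j, c (.inr a) (.inl (s, i)) (.inl (t, j)) = r * m s t * T i j a)
    (hqkq : ∀ a s i t j, c (.inl (s, i)) (.inr a) (.inl (t, j)) = -(r * m s t * T i j a))
    (hkqk : ∀ a i a', c (.inr a) (.inl i) (.inr a') = 0)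
    (hqkk : ∀ a i a', c (.inl i) (.inr a) (.inr a') = 0)
    (hkkq : ∀ a i a', c (.inr a) (.inr a') (.inl i) = 0)
    (hkkk : ∀ a a' a'', c (.inr a) (.inr a') (.inr a'') = 0)
    (hQqq : ∀ s i t j, Q (.inl (s, i)) (.inl (t, j)) = -(μ s t * ∑ a, T i j a ^ 2))
    (hQqk : ∀ s i a, Q (.inl (s, i)) (.inr a) = -(r ^ 2 * ∑ j, T i j a ^ 2))
    (hQkq : ∀ a t j, Q (.inr a) (.inl (t, j)) = -(ν t * ∑ i, T i j a ^ 2))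
    (hQkk : ∀ a, ∑ a', Q (.inr a) (.inr a') = -(r ^ 2 * S a)) :
    -(1 / 4) * ∑ i, ∑ j, ∑ k, c i j k ^ 2 + 1 / 2 * ∑ i, ∑ j, ∑ k, c k i j * c k j i
        - ∑ i, ∑ j, Q i j =
      -(N / 4) * (∑ s, ∑ t, (w s t ^ 2 + 2 * r ^ 2 * m s t ^ 2)) -
        N / 2 * (∑ s, ∑ t, (r ^ 2 * m s t * m t s + 2 * r * w s t * m s t)) +
        N * (∑ s, ∑ t, μ s t + 2 * r ^ 2 + ∑ t, ν t) + r ^ 2 * ∑ a, S a := by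
  have hN' : ∑ i, ∑ a, ∑ j, T i j a ^ 2 = N := by
    rw [← hN]; exact Finset.sum_congr rfl fun i _ => Finset.sum_comm
  have hN2 : ∑ a, ∑ i, ∑ j, T i j a ^ 2 = N := by
    rw [← hN', Finset.sum_comm]
  have hN3 : ∑ a, ∑ j, ∑ i, T i j a ^ 2 = N := by
    rw [← hN2]; exact Finset.sum_congr rfl fun i _ => Finset.sum_comm
  have hN4 : ∑ j, ∑ a, ∑ i, T i j a ^ 2 = N := by
    rw [← hN3, Finset.sum_comm]
  -- The three nonzero blocks of c_kij c_kji, according to which of i, j, k is a 𝔨-index. The minus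
  -- sign comes from `hqkq` in the first two and from the antisymmetry of T in the third.
  have hp1 : ∀ u v, ∑ a, ∑ j, ∑ i, -(u * T i j a) * (v * T i j a) = -(u * v * N) := fun u v => by
    rw [← hN3, ← neg_mul]
    simp only [Finset.mul_sum]
    exact Finset.sum_congr rfl fun _ _ => Finset.sum_congr rfl fun _ _ =>
      Finset.sum_congr rfl fun _ _ => by ring
  have hp2 : ∀ u v, ∑ j, ∑ a, ∑ i, v * T i j a * -(u * T i j a) = -(u * v * N) := fun u v => by
    rw [← hN4, ← neg_mul]
    simp only [Finset.mul_sum]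
    exact Finset.sum_congr rfl fun _ _ => Finset.sum_congr rfl fun _ _ =>
      Finset.sum_congr rfl fun _ _ => by ring
  have hp3 : ∀ u v, ∑ i, ∑ j, ∑ a, u * T i j a * (v * T j i a) = -(u * v * N) := fun u v => by
    rw [← hN, ← neg_mul]
    simp only [Finset.mul_sum]
    exact Finset.sum_congr rfl fun i _ => Finset.sum_congr rfl fun j _ =>
      Finset.sum_congr rfl fun a _ => by rw [hT i j]; ring
  simp only [Fintype.sum_sum_type, Fintype.sum_prod_type, hqqq, hqqk, hkqq, hqkq, hkqk, hqkk, hkkq,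
    hkkk, hQqq, hQqk, hQkq, Finset.sum_add_distrib, Fin.sum_univ_two, mul_pow, neg_sq,
    Finset.sum_neg_distrib, ← Finset.mul_sum, hN, hN', hN2, hN3, hQkk,
    hp1, hp2, hp3, Finset.sum_const_zero, ne_eq, OfNat.ofNat_ne_zero, not_false_eq_true, zero_pow]
  ring

/-! ### Symmetric pairs and their Casimir-type identities -/

theorem exists_orthonormal_basis_of_posDef {W : Type*} [AddCommGroup W] [Module ℝ W]
    [FiniteDimensional ℝ W] (B : LinearMap.BilinForm ℝ W) (hs : ∀ x y, B x y = B y x)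
    (hp : ∀ x, x ≠ 0 → 0 < B x x) :
    ∃ f : Fin (Module.finrank ℝ W) → W, (∀ i j, B (f i) (f j) = if i = j then 1 else 0) ∧
      ∀ v, ∑ i, B v (f i) • f i = v := by
  let c : InnerProductSpace.Core ℝ W :=
    { inner := fun x y => B x y
      conj_inner_symm := fun x y => hs y x
      re_inner_nonneg := fun x => by
        by_cases h : x = 0
        · simp [h]
        · exact (hp x h).le
      add_left := fun x y z => by simp
      smul_left := fun x y r => by simp
      definite := fun x hx => by
        by_contra h
        exact (hp x h).ne' hx }
  let _ : NormedAddCommGroup W := c.toNormedAddCommGroup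
  let _ : InnerProductSpace ℝ W := InnerProductSpace.ofCore c.toCore
  let o := stdOrthonormalBasis ℝ W
  refine ⟨o, fun i j => orthonormal_iff_ite.1 o.orthonormal i j, fun v => ?_⟩
  conv_rhs => rw [← o.sum_repr' v]
  exact Finset.sum_congr rfl fun i _ => by rw [hs]; rfl

/-- A Lie algebra with an involution, the opposite `B` of the Killing form, and orthonormal bases
`q`, `k` of the eigenspaces of the involution. -/
structure SymmetricFrame (L : Type*) [LieRing L] [LieAlgebra ℝ L] (α κ : Type*) [Fintype α]
    [Fintype κ] [DecidableEq α] [DecidableEq κ] where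
  B : LinearMap.BilinForm ℝ L
  B_eq : ∀ x y, B x y = -killingForm ℝ L x y
  θ : L ≃ₗ⁅ℝ⁆ L
  invol : ∀ x, θ (θ x) = x
  q : α → L
  k : κ → L
  θ_q : ∀ i, θ (q i) = -q i
  θ_k : ∀ a, θ (k a) = k a
  q_orth : ∀ i j, B (q i) (q j) = if i = j then 1 else 0
  k_orth : ∀ i j, B (k i) (k j) = if i = j then 1 else 0
  q_expand : ∀ x, θ x = -x → ∑ i, B x (q i) • q i = x
  k_expand : ∀ x, θ x = x → ∑ i, B x (k i) • k i = x

namespace SymmetricFrame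

variable {L : Type*} [LieRing L] [LieAlgebra ℝ L] {α κ : Type*} [Fintype α]
    [Fintype κ] [DecidableEq α] [DecidableEq κ] (S : SymmetricFrame L α κ)

theorem B_symm (x y : L) : S.B x y = S.B y x := by
  rw [S.B_eq, S.B_eq, LieModule.traceForm_comm]

theorem B_lie (x y z : L) : S.B ⁅x, y⁆ z = S.B x ⁅y, z⁆ := by
  rw [S.B_eq, S.B_eq]
  exact congrArg _ (LieModule.traceForm_apply_lie_apply ℝ L L x y z)

theorem B_θ [FiniteDimensional ℝ L] (x y : L) : S.B (S.θ x) (S.θ y) = S.B x y := by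
  rw [S.B_eq, S.B_eq, LieAlgebra.killingForm_of_equiv_apply]

/-- The projection onto the `-1` eigenspace. -/
def Q : L →ₗ[ℝ] L := (1 / 2 : ℝ) • (LinearMap.id - (S.θ : L →ₗ[ℝ] L))

/-- The projection onto the `1` eigenspace. -/
def K : L →ₗ[ℝ] L := (1 / 2 : ℝ) • (LinearMap.id + (S.θ : L →ₗ[ℝ] L))

theorem Q_apply (x : L) : S.Q x = (1 / 2 : ℝ) • (x - S.θ x) := rfl

theorem K_apply (x : L) : S.K x = (1 / 2 : ℝ) • (x + S.θ x) := rfl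

theorem Q_add_K (x : L) : S.Q x + S.K x = x := by
  rw [Q_apply, K_apply, ← smul_add]
  rw [sub_add_add_cancel, ← two_smul ℝ x, smul_smul]
  norm_num

theorem θ_Q (x : L) : S.θ (S.Q x) = -S.Q x := by
  rw [Q_apply, map_smul, map_sub, S.invol, ← smul_neg, neg_sub]

theorem θ_K (x : L) : S.θ (S.K x) = S.K x := by
  rw [K_apply, map_smul, map_add, S.invol, add_comm]

theorem Q_of_neg {x : L} (h : S.θ x = -x) : S.Q x = x := by
  rw [Q_apply, h, sub_neg_eq_add, ← two_smul ℝ x, smul_smul]; norm_num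

theorem Q_of_pos {x : L} (h : S.θ x = x) : S.Q x = 0 := by rw [Q_apply, h, sub_self, smul_zero]

theorem K_of_pos {x : L} (h : S.θ x = x) : S.K x = x := by
  rw [K_apply, h, ← two_smul ℝ x, smul_smul]; norm_num

theorem K_of_neg {x : L} (h : S.θ x = -x) : S.K x = 0 := by
  rw [K_apply, h, add_neg_cancel, smul_zero]

/-- Automorphisms preserve the Killing form, so the two eigenspaces are orthogonal. -/
theorem B_of_neg_of_pos [FiniteDimensional ℝ L] {x y : L} (hx : S.θ x = -x) (hy : S.θ y = y) :
    S.B x y = 0 := by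
  have := S.B_θ x y
  rw [hx, hy, map_neg, LinearMap.neg_apply] at this
  linarith

theorem B_Q_left [FiniteDimensional ℝ L] (x y : L) : S.B (S.Q x) (S.Q y) = S.B (S.Q x) y := by
  conv_rhs => rw [← S.Q_add_K y, map_add, S.B_of_neg_of_pos (S.θ_Q x) (S.θ_K y), add_zero]

theorem B_Q_symm [FiniteDimensional ℝ L] (x y : L) : S.B (S.Q x) y = S.B (S.Q y) x := by
  rw [← B_Q_left, S.B_symm, B_Q_left]

theorem B_K_left [FiniteDimensional ℝ L] (x y : L) : S.B (S.K x) (S.K y) = S.B (S.K x) y := by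
  conv_rhs => rw [← S.Q_add_K y, map_add, S.B_symm _ (S.Q y),
    S.B_of_neg_of_pos (S.θ_Q y) (S.θ_K x), zero_add]

theorem B_K_symm [FiniteDimensional ℝ L] (x y : L) : S.B (S.K x) y = S.B (S.K y) x := by
  rw [← B_K_left, S.B_symm, B_K_left]

theorem Q_lie {z : L} (hz : S.θ z = z) (x : L) : S.Q ⁅z, x⁆ = ⁅z, S.Q x⁆ := by
  rw [Q_apply, Q_apply, LieEquiv.map_lie, hz, lie_smul, lie_sub]

theorem K_lie {z : L} (hz : S.θ z = z) (x : L) : S.K ⁅z, x⁆ = ⁅z, S.K x⁆ := by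
  rw [K_apply, K_apply, LieEquiv.map_lie, hz, lie_smul, lie_add]

theorem B_lie_symm (z x y : L) : S.B ⁅z, x⁆ y = -S.B ⁅z, y⁆ x := by
  rw [← lie_skew, map_neg, LinearMap.neg_apply, B_lie, S.B_symm x]

/-- The form on `L × L` induced by the invariant metric on the homogeneous space. -/
def form (x₁ x₂ x₃ x₄ : ℝ) (X Y : L × L) : ℝ :=
  x₁ * S.B (S.Q X.1) Y.1 + x₂ * S.B (S.Q X.2) Y.2 +
    -- The difference X.1 - X.2 kills the diagonal of 𝔨 and equals 2Z on (Z, -Z), so the factor x₃/2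
    -- produces the prescribed 2x₃.
    x₄ * (S.B (S.Q X.1) Y.2 + S.B (S.Q X.2) Y.1) + x₃ / 2 * S.B (S.K (X.1 - X.2)) (Y.1 - Y.2)

theorem form_invariant [FiniteDimensional ℝ L] (x₁ x₂ x₃ x₄ : ℝ) {z : L} (hz : S.θ z = z)
    (X Y : L × L) : S.form x₁ x₂ x₃ x₄ (⁅z, X.1⁆, ⁅z, X.2⁆) Y =
      -S.form x₁ x₂ x₃ x₄ X (⁅z, Y.1⁆, ⁅z, Y.2⁆) := by
  have hQ : ∀ x y, S.B (S.Q ⁅z, x⁆) y = -S.B (S.Q x) ⁅z, y⁆ := fun x y => by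
    rw [S.Q_lie hz, B_lie_symm, S.B_symm]
  have hK : ∀ x y, S.B (S.K ⁅z, x⁆) y = -S.B (S.K x) ⁅z, y⁆ := fun x y => by
    rw [S.K_lie hz, B_lie_symm, S.B_symm]
  simp only [form, ← lie_sub, hQ, hK]
  ring

/-- The structure constants of the symmetric pair. -/
def T (i j : α) (a : κ) : ℝ := S.B ⁅S.q i, S.q j⁆ (S.k a)

theorem T_swap (i j : α) (a : κ) : S.T j i a = -S.T i j a := by
  rw [T, ← lie_skew, map_neg, LinearMap.neg_apply, T]

theorem θ_lie_qq {x y : L} (hx : S.θ x = -x) (hy : S.θ y = -y) : S.θ ⁅x, y⁆ = ⁅x, y⁆ := by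
  rw [LieEquiv.map_lie, hx, hy, neg_lie, lie_neg, neg_neg]

theorem θ_lie_kq {x y : L} (hx : S.θ x = x) (hy : S.θ y = -y) : S.θ ⁅x, y⁆ = -⁅x, y⁆ := by
  rw [LieEquiv.map_lie, hx, hy, lie_neg]

theorem θ_lie_qk {x y : L} (hx : S.θ x = -x) (hy : S.θ y = y) : S.θ ⁅x, y⁆ = -⁅x, y⁆ := by
  rw [LieEquiv.map_lie, hx, hy, neg_lie]

theorem θ_lie_kk {x y : L} (hx : S.θ x = x) (hy : S.θ y = y) : S.θ ⁅x, y⁆ = ⁅x, y⁆ := by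
  rw [LieEquiv.map_lie, hx, hy]

theorem B_kq_q (a : κ) (i j : α) : S.B ⁅S.k a, S.q i⁆ (S.q j) = S.T i j a := by
  rw [B_lie, S.B_symm, T]

theorem B_qk_q (a : κ) (i j : α) : S.B ⁅S.q i, S.k a⁆ (S.q j) = -S.T i j a := by
  rw [← lie_skew, map_neg, LinearMap.neg_apply, B_kq_q]

theorem B_eq_sum_q {x : L} (h : S.θ x = -x) (y : L) :
    S.B x y = ∑ i, S.B x (S.q i) * S.B y (S.q i) := by
  conv_lhs => rw [← S.q_expand x h]
  simp only [map_sum, LinearMap.sum_apply, map_smul, LinearMap.smul_apply, smul_eq_mul]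
  exact Finset.sum_congr rfl fun i _ => by rw [S.B_symm y]

theorem B_eq_sum_k {x : L} (h : S.θ x = x) (y : L) :
    S.B x y = ∑ i, S.B x (S.k i) * S.B y (S.k i) := by
  conv_lhs => rw [← S.k_expand x h]
  simp only [map_sum, LinearMap.sum_apply, map_smul, LinearMap.smul_apply, smul_eq_mul]
  exact Finset.sum_congr rfl fun i _ => by rw [S.B_symm y]

theorem norm_qq (i j : α) : S.B ⁅S.q i, S.q j⁆ ⁅S.q i, S.q j⁆ = ∑ a, S.T i j a ^ 2 := by
  rw [S.B_eq_sum_k (S.θ_lie_qq (S.θ_q i) (S.θ_q j))]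
  exact Finset.sum_congr rfl fun a _ => (sq _).symm

theorem norm_kq (a : κ) (i : α) : S.B ⁅S.k a, S.q i⁆ ⁅S.k a, S.q i⁆ = ∑ j, S.T i j a ^ 2 := by
  rw [S.B_eq_sum_q (S.θ_lie_kq (S.θ_k a) (S.θ_q i))]
  exact Finset.sum_congr rfl fun j _ => by rw [B_kq_q, sq]

/-- The trace of an endomorphism in the basis of the frame. -/
theorem trace_eq [FiniteDimensional ℝ L] (f : L →ₗ[ℝ] L) :
    LinearMap.trace ℝ L f = ∑ i, S.B (f (S.q i)) (S.q i) + ∑ a, S.B (f (S.k a)) (S.k a) := by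
  have horth : ∀ i j : α ⊕ κ, S.B (Sum.elim S.q S.k i) (Sum.elim S.q S.k j) =
      if i = j then 1 else 0 := by
    rintro (i | i) (j | j)
    · simp [S.q_orth]
    · simp [S.B_of_neg_of_pos (S.θ_q i) (S.θ_k j)]
    · simp [S.B_symm (S.k i), S.B_of_neg_of_pos (S.θ_q j) (S.θ_k i)]
    · simp [S.k_orth]
  have hexp : ∀ x, ∑ i, S.B x (Sum.elim S.q S.k i) • Sum.elim S.q S.k i = x := fun x => by
    rw [Fintype.sum_sum_type]
    simp only [Sum.elim_inl, Sum.elim_inr]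
    conv_rhs => rw [← S.Q_add_K x, ← S.q_expand _ (S.θ_Q x), ← S.k_expand _ (S.θ_K x)]
    congr 1
    · refine Finset.sum_congr rfl fun i _ => ?_
      rw [S.B_Q_symm, S.Q_of_neg (S.θ_q i), S.B_symm]
    · refine Finset.sum_congr rfl fun i _ => ?_
      rw [S.B_K_symm, S.K_of_pos (S.θ_k i), S.B_symm]
  have hli : LinearIndependent ℝ (Sum.elim S.q S.k) := by
    rw [Fintype.linearIndependent_iff]
    intro g hg i
    have := congrArg (fun v => S.B v (Sum.elim S.q S.k i)) hg
    simpa only [map_sum, LinearMap.sum_apply, map_smul, LinearMap.smul_apply, horth, smul_eq_mul,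
      mul_ite, mul_one, mul_zero, Finset.sum_ite_eq', Finset.sum_ite_eq, Finset.mem_univ, if_true,
      map_zero, LinearMap.zero_apply] using this
  have hsp : ⊤ ≤ Submodule.span ℝ (Set.range (Sum.elim S.q S.k)) := fun v _ => by
    rw [← hexp v]
    exact Submodule.sum_mem _ fun i _ => Submodule.smul_mem _ _ (Submodule.subset_span ⟨i, rfl⟩)
  let bs := Module.Basis.mk hli hsp
  have hbs : ∀ i, bs i = Sum.elim S.q S.k i := fun i => Module.Basis.mk_apply hli hsp i
  have hco : ∀ v i, bs.repr v i = S.B v (Sum.elim S.q S.k i) := fun v i => by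
    have : v = ∑ i, S.B v (Sum.elim S.q S.k i) • bs i := by simp only [hbs, hexp]
    conv_lhs => rw [this]
    rw [Module.Basis.repr_sum_self]
  rw [LinearMap.trace_eq_matrix_trace ℝ bs, Matrix.trace, Fintype.sum_sum_type]
  simp only [Matrix.diag, LinearMap.toMatrix_apply, hco, hbs, Sum.elim_inl, Sum.elim_inr]

/-- B(x, x) = -tr(ad x)², and ad x is skew for B, so each diagonal entry of -(ad x)² is a squared
norm. -/
theorem B_self_eq [FiniteDimensional ℝ L] (x : L) :
    S.B x x = ∑ i, S.B ⁅x, S.q i⁆ ⁅x, S.q i⁆ + ∑ a, S.B ⁅x, S.k a⁆ ⁅x, S.k a⁆ := by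
  have h : ∀ y, S.B ⁅x, ⁅x, y⁆⁆ y = -S.B ⁅x, y⁆ ⁅x, y⁆ := fun y => by rw [B_lie_symm]
  rw [S.B_eq x x, killingForm_apply_apply, S.trace_eq]
  simp only [LinearMap.comp_apply, LieAlgebra.ad_apply, h, Finset.sum_neg_distrib]
  ring

/-- Applying `B_self_eq` to a unit vector q_i, the brackets with 𝔮 and those with 𝔨 contribute the
same sum of T², so each q_i accounts for exactly 1/2. -/
theorem sum_T_sq [FiniteDimensional ℝ L] :
    ∑ i, ∑ j, ∑ a, S.T i j a ^ 2 = (Fintype.card α : ℝ) / 2 := by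
  have h : ∀ i, (1 : ℝ) = 2 * ∑ j, ∑ a, S.T i j a ^ 2 := fun i => by
    have h1 := S.B_self_eq (S.q i)
    have h2 : ∀ a, S.B ⁅S.q i, S.k a⁆ ⁅S.q i, S.k a⁆ = ∑ j, S.T i j a ^ 2 := fun a => by
      rw [← lie_skew, map_neg, map_neg, LinearMap.neg_apply, neg_neg, norm_kq]
    rw [S.q_orth, if_pos rfl] at h1
    simp only [norm_qq, h2] at h1
    rw [Finset.sum_comm (f := fun a j => S.T i j a ^ 2)] at h1
    linarith
  have := Finset.sum_congr (s₁ := Finset.univ) rfl fun i _ => h i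
  rw [← Finset.mul_sum, Finset.sum_const, Finset.card_univ, nsmul_eq_mul, mul_one] at this
  linarith

/-- `B_self_eq` for the unit vectors k_a, summed over a: the brackets with 𝔮 take n/2 of the total
d. -/
theorem sum_norm_kk [FiniteDimensional ℝ L] :
    ∑ a, ∑ a', S.B ⁅S.k a, S.k a'⁆ ⁅S.k a, S.k a'⁆ =
      (Fintype.card κ : ℝ) - (Fintype.card α : ℝ) / 2 := by
  have h : ∀ a, (1 : ℝ) = ∑ i, ∑ j, S.T i j a ^ 2 +
      ∑ a', S.B ⁅S.k a, S.k a'⁆ ⁅S.k a, S.k a'⁆ := fun a => by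
    have h1 := S.B_self_eq (S.k a)
    rw [S.k_orth, if_pos rfl] at h1
    simpa only [norm_kq] using h1
  have := Finset.sum_congr (s₁ := Finset.univ) rfl fun i _ => h i
  rw [Finset.sum_const, Finset.card_univ, nsmul_eq_mul, mul_one, Finset.sum_add_distrib] at this
  have e : ∑ a, ∑ i, ∑ j, S.T i j a ^ 2 = ∑ i, ∑ j, ∑ a, S.T i j a ^ 2 := by
    rw [Finset.sum_comm]
    exact Finset.sum_congr rfl fun _ _ => Finset.sum_comm
  rw [e, S.sum_T_sq] at this
  linarith

end SymmetricFrame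

/-! ### Structure constants of the product algebra in the adapted frame -/

namespace SymmetricFrame

variable {L : Type*} [LieRing L] [LieAlgebra ℝ L] {α κ : Type*} [Fintype α]
    [Fintype κ] [DecidableEq α] [DecidableEq κ] (S : SymmetricFrame L α κ)

/-- The lifts to `L × L` of an orthonormal basis of the tangent space. -/
def ev (v w : Fin 2 → ℝ) (r : ℝ) : (Fin 2 × α) ⊕ κ → L × L
  | .inl (s, i) => (v s • S.q i, w s • S.q i)
  | .inr a => (r • S.k a, (-r) • S.k a)

/-- The bracket of the product Lie algebra. -/
def brk {L : Type*} [LieRing L] (X Y : L × L) : L × L := (⁅X.1, Y.1⁆, ⁅X.2, Y.2⁆)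

theorem brk_smul (c c' d d' : ℝ) (x y : L) :
    brk (c • x, c' • x) (d • y, d' • y) = ((c * d) • ⁅x, y⁆, (c' * d') • ⁅x, y⁆) := by
  simp only [brk, lie_smul, smul_lie, smul_smul, mul_comm]

variable (x₁ x₂ x₃ x₄ : ℝ)

theorem form_of_pos {z : L} (hz : S.θ z = z) (c c' d d' : ℝ) (y : L) :
    S.form x₁ x₂ x₃ x₄ (c • z, c' • z) (d • y, d' • y) =
      x₃ / 2 * (c - c') * (d - d') * S.B z y := by
  simp only [form, map_smul, map_sub, S.Q_of_pos hz, S.K_of_pos hz, smul_zero, map_zero,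
    LinearMap.zero_apply, LinearMap.smul_apply, LinearMap.sub_apply, smul_eq_mul]
  ring

theorem form_of_neg {z : L} (hz : S.θ z = -z) (c c' d d' : ℝ) (y : L) :
    S.form x₁ x₂ x₃ x₄ (c • z, c' • z) (d • y, d' • y) =
      (x₁ * c * d + x₂ * c' * d' + x₄ * (c * d' + c' * d)) * S.B z y := by
  simp only [form, map_smul, map_sub, S.Q_of_neg hz, S.K_of_neg hz, smul_zero, map_zero,
    LinearMap.zero_apply, LinearMap.smul_apply, sub_zero, smul_eq_mul]
  ring

theorem B_of_pos_of_neg [FiniteDimensional ℝ L] {x y : L} (hx : S.θ x = x) (hy : S.θ y = -y) :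
    S.B x y = 0 := by
  rw [S.B_symm, S.B_of_neg_of_pos hy hx]

variable [FiniteDimensional ℝ L] {x₁ x₂ x₃ x₄} {v w : Fin 2 → ℝ} {r : ℝ}

theorem form_ev (hr : 2 * x₃ * r ^ 2 = 1)
    (hvw : ∀ s t, x₁ * v s * v t + x₂ * w s * w t + x₄ * (v s * w t + w s * v t) =
      if s = t then 1 else 0) (i j : (Fin 2 × α) ⊕ κ) :
    S.form x₁ x₂ x₃ x₄ (S.ev v w r i) (S.ev v w r j) = if i = j then 1 else 0 := by
  rcases i with ⟨s, i⟩ | a <;> rcases j with ⟨t, j⟩ | a'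
  · simp only [ev, S.form_of_neg _ _ _ _ (S.θ_q i), hvw, S.q_orth, Sum.inl.injEq, Prod.mk.injEq]
    split_ifs <;> simp_all
  · simp only [ev, S.form_of_neg _ _ _ _ (S.θ_q i), S.B_of_neg_of_pos (S.θ_q i) (S.θ_k a'),
      mul_zero, reduceCtorEq, if_false]
  · simp only [ev, S.form_of_pos _ _ _ _ (S.θ_k a), S.B_of_pos_of_neg (S.θ_k a) (S.θ_q j),
      mul_zero, reduceCtorEq, if_false]
  · simp only [ev, S.form_of_pos _ _ _ _ (S.θ_k a), S.k_orth, Sum.inr.injEq]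
    split_ifs
    · linear_combination hr
    · ring

/-- The structure constants in the basis `ev`. -/
def cst (x₁ x₂ x₃ x₄ : ℝ) (v w : Fin 2 → ℝ) (r : ℝ) (i j l : (Fin 2 × α) ⊕ κ) : ℝ :=
  S.form x₁ x₂ x₃ x₄ (brk (S.ev v w r i) (S.ev v w r j)) (S.ev v w r l)

/-- The form evaluated on the iterated brackets of `ev`. -/
def dbl (x₁ x₂ x₃ x₄ : ℝ) (v w : Fin 2 → ℝ) (r : ℝ) (i j : (Fin 2 × α) ⊕ κ) : ℝ :=
  S.form x₁ x₂ x₃ x₄ (brk (brk (S.ev v w r i) (S.ev v w r j)) (S.ev v w r j)) (S.ev v w r i)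

theorem cst_qqq (i j l : Fin 2 × α) :
    S.cst x₁ x₂ x₃ x₄ v w r (.inl i) (.inl j) (.inl l) = 0 := by
  obtain ⟨s, i⟩ := i; obtain ⟨t, j⟩ := j; obtain ⟨u, l⟩ := l
  have h := S.θ_lie_qq (S.θ_q i) (S.θ_q j)
  simp only [cst, ev, brk_smul, S.form_of_pos _ _ _ _ h, S.B_of_pos_of_neg h (S.θ_q l), mul_zero]

theorem cst_qqk (s : Fin 2) (i : α) (t : Fin 2) (j : α) (a : κ) :
    S.cst x₁ x₂ x₃ x₄ v w r (.inl (s, i)) (.inl (t, j)) (.inr a) =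
      x₃ * r * (v s * v t - w s * w t) * S.T i j a := by
  simp only [cst, ev, brk_smul, S.form_of_pos _ _ _ _ (S.θ_lie_qq (S.θ_q i) (S.θ_q j)), T]
  ring

theorem cst_kqq (a : κ) (s : Fin 2) (i : α) (t : Fin 2) (j : α) :
    S.cst x₁ x₂ x₃ x₄ v w r (.inr a) (.inl (s, i)) (.inl (t, j)) =
      r * (x₁ * v s * v t - x₂ * w s * w t + x₄ * (v s * w t - w s * v t)) * S.T i j a := by
  simp only [cst, ev, brk_smul, S.form_of_neg _ _ _ _ (S.θ_lie_kq (S.θ_k a) (S.θ_q i)), S.B_kq_q]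
  ring

theorem cst_qkq (a : κ) (s : Fin 2) (i : α) (t : Fin 2) (j : α) :
    S.cst x₁ x₂ x₃ x₄ v w r (.inl (s, i)) (.inr a) (.inl (t, j)) =
      -(r * (x₁ * v s * v t - x₂ * w s * w t + x₄ * (v s * w t - w s * v t)) * S.T i j a) := by
  simp only [cst, ev, brk_smul, S.form_of_neg _ _ _ _ (S.θ_lie_qk (S.θ_q i) (S.θ_k a)), S.B_qk_q]
  ring

theorem cst_kqk (a : κ) (i : Fin 2 × α) (a' : κ) :
    S.cst x₁ x₂ x₃ x₄ v w r (.inr a) (.inl i) (.inr a') = 0 := by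
  have h := S.θ_lie_kq (S.θ_k a) (S.θ_q i.2)
  simp only [cst, ev, brk_smul, S.form_of_neg _ _ _ _ h, S.B_of_neg_of_pos h (S.θ_k a'), mul_zero]

theorem cst_qkk (a : κ) (i : Fin 2 × α) (a' : κ) :
    S.cst x₁ x₂ x₃ x₄ v w r (.inl i) (.inr a) (.inr a') = 0 := by
  have h := S.θ_lie_qk (S.θ_q i.2) (S.θ_k a)
  simp only [cst, ev, brk_smul, S.form_of_neg _ _ _ _ h, S.B_of_neg_of_pos h (S.θ_k a'), mul_zero]

theorem cst_kkq (a : κ) (i : Fin 2 × α) (a' : κ) :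
    S.cst x₁ x₂ x₃ x₄ v w r (.inr a) (.inr a') (.inl i) = 0 := by
  have h := S.θ_lie_kk (S.θ_k a) (S.θ_k a')
  simp only [cst, ev, brk_smul, S.form_of_pos _ _ _ _ h, S.B_of_pos_of_neg h (S.θ_q _), mul_zero]

/-- The bracket of (Z, -Z) and (W, -W) is ([Z, W], [Z, W]), which lies in the isotropy algebra. The
iterated brackets in `dbl_kk` nevertheless contribute. -/
theorem cst_kkk (a a' a'' : κ) : S.cst x₁ x₂ x₃ x₄ v w r (.inr a) (.inr a') (.inr a'') = 0 := by
  have h := S.θ_lie_kk (S.θ_k a) (S.θ_k a')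
  simp only [cst, ev, brk_smul, S.form_of_pos _ _ _ _ h]
  ring

theorem B_lie_lie (x y : L) : S.B ⁅⁅x, y⁆, y⁆ x = -S.B ⁅x, y⁆ ⁅x, y⁆ := by
  rw [S.B_lie, ← lie_skew y x, map_neg]

theorem dbl_qq (s : Fin 2) (i : α) (t : Fin 2) (j : α) :
    S.dbl x₁ x₂ x₃ x₄ v w r (.inl (s, i)) (.inl (t, j)) =
      -((x₁ * v s * v t * v t * v s + x₂ * w s * w t * w t * w s +
        x₄ * (v s * v t * v t * w s + w s * w t * w t * v s)) * ∑ a, S.T i j a ^ 2) := by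
  have h := S.θ_lie_kq (S.θ_lie_qq (S.θ_q i) (S.θ_q j)) (S.θ_q j)
  simp only [dbl, ev, brk_smul, S.form_of_neg _ _ _ _ h, B_lie_lie, norm_qq]
  ring

theorem dbl_qk (hvw : ∀ s, x₁ * v s * v s + x₂ * w s * w s + x₄ * (v s * w s + w s * v s) = 1)
    (s : Fin 2) (i : α) (a : κ) : S.dbl x₁ x₂ x₃ x₄ v w r (.inl (s, i)) (.inr a) =
      -(r ^ 2 * ∑ j, S.T i j a ^ 2) := by
  have h := S.θ_lie_qk (S.θ_lie_qk (S.θ_q i) (S.θ_k a)) (S.θ_k a)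
  have e : S.B ⁅S.q i, S.k a⁆ ⁅S.q i, S.k a⁆ = ∑ j, S.T i j a ^ 2 := by
    rw [← lie_skew, map_neg, map_neg, LinearMap.neg_apply, neg_neg, norm_kq]
  simp only [dbl, ev, brk_smul, S.form_of_neg _ _ _ _ h, B_lie_lie, e]
  linear_combination (-(r ^ 2 * ∑ j, S.T i j a ^ 2)) * hvw s

theorem dbl_kq (a : κ) (t : Fin 2) (j : α) : S.dbl x₁ x₂ x₃ x₄ v w r (.inr a) (.inl (t, j)) =
    -(x₃ * r ^ 2 * (v t ^ 2 + w t ^ 2) * ∑ i, S.T i j a ^ 2) := by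
  have h := S.θ_lie_qq (S.θ_lie_kq (S.θ_k a) (S.θ_q j)) (S.θ_q j)
  have e : ∑ i, S.T i j a ^ 2 = ∑ i, S.T j i a ^ 2 :=
    Finset.sum_congr rfl fun i _ => by rw [T_swap, neg_sq]
  simp only [dbl, ev, brk_smul, S.form_of_pos _ _ _ _ h, B_lie_lie, norm_kq, e]
  ring

theorem dbl_kk (hr : 2 * x₃ * r ^ 2 = 1) (a : κ) :
    ∑ a', S.dbl x₁ x₂ x₃ x₄ v w r (.inr a) (.inr a') =
    -(r ^ 2 * ∑ a', S.B ⁅S.k a, S.k a'⁆ ⁅S.k a, S.k a'⁆) := by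
  rw [Finset.mul_sum, ← Finset.sum_neg_distrib]
  refine Finset.sum_congr rfl fun a' _ => ?_
  have h := S.θ_lie_kk (S.θ_lie_kk (S.θ_k a) (S.θ_k a')) (S.θ_k a')
  simp only [dbl, ev, brk_smul, S.form_of_pos _ _ _ _ h, B_lie_lie]
  linear_combination (-(r ^ 2 * S.B ⁅S.k a, S.k a'⁆ ⁅S.k a, S.k a'⁆)) * hr

theorem cst_unimodular (l : (Fin 2 × α) ⊕ κ) : ∑ j, S.cst x₁ x₂ x₃ x₄ v w r j l j = 0 := by
  have hT : ∀ i a, S.T i i a = 0 := fun i a => by have := S.T_swap i i a; linarith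
  rw [Fintype.sum_sum_type]
  rcases l with l | a
  · simp [cst_qqq, cst_kqk]
  · simp [cst_qkq, cst_kkk, hT, Fintype.sum_prod_type]

/-- The scalar curvature of the homogeneous space, from its structure constants. -/
theorem sum_cst_eq (hx₁ : 0 < x₁) (hx₃ : 0 < x₃) (hx : x₄ ^ 2 < x₁ * x₂) :
    ∃ (v w : Fin 2 → ℝ) (r : ℝ),
      2 * x₃ * r ^ 2 = 1 ∧
      (∀ s t, x₁ * v s * v t + x₂ * w s * w t + x₄ * (v s * w t + w s * v t) =
        if s = t then 1 else 0) ∧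
      -(1 / 4) * ∑ i, ∑ j, ∑ k, S.cst x₁ x₂ x₃ x₄ v w r i j k ^ 2 +
        1 / 2 * ∑ i, ∑ j, ∑ k, S.cst x₁ x₂ x₃ x₄ v w r k i j * S.cst x₁ x₂ x₃ x₄ v w r k j i
        - ∑ i, ∑ j, S.dbl x₁ x₂ x₃ x₄ v w r i j =
      Fintype.card κ / (2 * x₃) - Fintype.card α *
        (x₂ ^ 2 * x₃ ^ 2 + x₁ ^ 2 * (4 * x₂ ^ 2 - 8 * x₂ * x₃ + x₃ ^ 2) + 8 * x₂ * x₃ * x₄ ^ 2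
            + 8 * x₁ * x₃ * (x₄ ^ 2 - x₂ ^ 2) - 2 * x₄ ^ 2 * (x₃ ^ 2 + 2 * x₄ ^ 2))
          / (16 * x₃ * (x₄ ^ 2 - x₁ * x₂) ^ 2) := by
  have hD : 0 < x₁ * x₂ - x₄ ^ 2 := by linarith
  -- Gram-Schmidt applied to (1, 0), (0, 1) for the matrix with rows (x₁, x₄), (x₄, x₂) gives (p, 0)
  -- and q(-x₄/x₁, 1).
  obtain ⟨p, hp⟩ : ∃ p : ℝ, p ^ 2 = 1 / x₁ := ⟨√(1 / x₁), Real.sq_sqrt (by positivity)⟩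
  obtain ⟨q, hq⟩ : ∃ q : ℝ, q ^ 2 = x₁ / (x₁ * x₂ - x₄ ^ 2) :=
    ⟨√(x₁ / (x₁ * x₂ - x₄ ^ 2)), Real.sq_sqrt (by positivity)⟩
  obtain ⟨r, hr⟩ : ∃ r : ℝ, r ^ 2 = 1 / (2 * x₃) := ⟨√(1 / (2 * x₃)), Real.sq_sqrt (by positivity)⟩
  have hr' : 2 * x₃ * r ^ 2 = 1 := by rw [hr]; field_simp
  have hvw : ∀ s t, x₁ * ![p, -x₄ / x₁ * q] s * ![p, -x₄ / x₁ * q] t +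
      x₂ * ![0, q] s * ![0, q] t +
      x₄ * (![p, -x₄ / x₁ * q] s * ![0, q] t + ![0, q] s * ![p, -x₄ / x₁ * q] t) =
        if s = t then 1 else 0 := by
    have h00 : x₁ * p * p = 1 := by
      rw [mul_assoc, ← sq, hp]; field_simp
    have h11 : x₁ * (-x₄ / x₁ * q) * (-x₄ / x₁ * q) + x₂ * q * q +
        x₄ * (-x₄ / x₁ * q * q + q * (-x₄ / x₁ * q)) = 1 := by
      have : x₁ * (-x₄ / x₁ * q) * (-x₄ / x₁ * q) + x₂ * q * q +
        x₄ * (-x₄ / x₁ * q * q + q * (-x₄ / x₁ * q)) = (x₁ * x₂ - x₄ ^ 2) / x₁ * q ^ 2 := by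
        field_simp; ring
      rw [this, hq]; field_simp
    have h01 : x₁ * p * (-x₄ / x₁ * q) + x₄ * (p * q) = 0 := by field_simp; ring
    intro s t
    fin_cases s <;> fin_cases t
    · simpa using h00
    · simpa using h01
    · simp; linear_combination h01
    · simpa using h11
  refine ⟨![p, -x₄ / x₁ * q], ![0, q], r, hr', hvw, ?_⟩
  rw [sum_structureConstants (S.cst x₁ x₂ x₃ x₄ _ _ r) (S.dbl x₁ x₂ x₃ x₄ _ _ r) S.T
    (fun a => ∑ a', S.B ⁅S.k a, S.k a'⁆ ⁅S.k a, S.k a'⁆) (Fintype.card α / 2) r _ _ _ _ S.T_swap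
    S.sum_T_sq S.cst_qqq S.cst_qqk S.cst_kqq S.cst_qkq S.cst_kqk S.cst_qkk S.cst_kkq S.cst_kkk
    S.dbl_qq (S.dbl_qk fun s => by simpa using hvw s s) S.dbl_kq (S.dbl_kk hr'), S.sum_norm_kk]
  simp only [Fin.sum_univ_two, Matrix.cons_val_zero, Matrix.cons_val_one]
  generalize (Fintype.card α : ℝ) = n
  generalize (Fintype.card κ : ℝ) = d
  have hp4 : p ^ 4 = (1 / x₁) ^ 2 := by rw [← hp]; ring
  have hq4 : q ^ 4 = (x₁ / (x₁ * x₂ - x₄ ^ 2)) ^ 2 := by rw [← hq]; ring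
  have hD' : x₄ ^ 2 - x₁ * x₂ ≠ 0 := by linarith
  have hD2 : x₁ * x₂ - x₄ ^ 2 ≠ 0 := hD.ne'
  -- The target is hidden so that `ring_nf` expands only the left side. There p, q, r occur through
  -- p², p⁴, q², q⁴, r² alone, so no square root survives.
  generalize hR : (d : ℝ) / (2 * x₃) - _ = R
  ring_nf
  simp only [hp, hq, hr, hp4, hq4]
  rw [← hR, ← neg_sub (x₁ * x₂), neg_sq]
  field_simp
  ring

end SymmetricFrame

/-! ### The Maurer-Cartan form of a Lie group and its structure equation -/

theorem contDiffAt_clm_of_apply {D E F : Type*} [NormedAddCommGroup D] [NormedSpace ℝ D]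
    [NormedAddCommGroup E] [NormedSpace ℝ E] [FiniteDimensional ℝ E] [NormedAddCommGroup F]
    [NormedSpace ℝ F] {n : ℕ∞ω} {f : D → E →L[ℝ] F} {u : D}
    (h : ∀ y, ContDiffAt ℝ n (fun x => f x y) u) : ContDiffAt ℝ n f u := by
  let c := Module.finBasis ℝ E
  have e : f = fun x => ∑ i, ContinuousLinearMap.smulRightL ℝ E F
      (LinearMap.toContinuousLinearMap (c.coord i)) (f x (c i)) := by
    funext x
    ext y
    calc f x y = f x (∑ i, c.repr y i • c i) := by rw [c.sum_repr]
      _ = _ := by simp only [map_sum, map_smul, sum_apply]; rfl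
  rw [e]
  exact ContDiffAt.sum fun i _ =>
    (ContinuousLinearMap.contDiff _).contDiffAt.comp u (h (c i))

section MaurerCartan

variable {E : Type*} [NormedAddCommGroup E] [NormedSpace ℝ E]
  {H : Type*} [TopologicalSpace H] [ChartedSpace E H] [Group H]

/-- The differential at `1` of the left translation by `h`. -/
def leftDeriv (h : H) : E →L[ℝ] E := mfderiv 𝓘(ℝ, E) 𝓘(ℝ, E) (fun x : H => h * x) 1

variable {F : Type*} [NormedAddCommGroup F] [NormedSpace ℝ F]

/-- The derivative of a map from a vector space to `H`. -/
def derivTo (E : Type*) [NormedAddCommGroup E] [NormedSpace ℝ E]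
    {H : Type*} [TopologicalSpace H] [ChartedSpace E H] (σ : F → H) (u : F) : F →L[ℝ] E :=
  mfderiv 𝓘(ℝ, F) 𝓘(ℝ, E) σ u

/-- The pullback by `σ` of the left Maurer-Cartan form of `H`. -/
def mcForm (E : Type*) [NormedAddCommGroup E] [NormedSpace ℝ E]
    {H : Type*} [TopologicalSpace H] [ChartedSpace E H] [Group H] (σ : F → H) (u : F) :
    F →L[ℝ] E :=
  (leftDeriv (E := E) (σ u)).inverse ∘L derivTo E σ u

/-- The derivative of the inverse of the chart around `a`. -/
def symmDeriv (E : Type*) [NormedAddCommGroup E] [NormedSpace ℝ E]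
    {H : Type*} [TopologicalSpace H] [ChartedSpace E H] (a : H) (x : E) : E →L[ℝ] E :=
  mfderiv 𝓘(ℝ, E) 𝓘(ℝ, E) (extChartAt 𝓘(ℝ, E) a).symm x

/-- The left-invariant vector fields in the chart around `a`. -/
def chartField (E : Type*) [NormedAddCommGroup E] [NormedSpace ℝ E]
    {H : Type*} [TopologicalSpace H] [ChartedSpace E H] [Group H] (a : H) (x : E) : E →L[ℝ] E :=
  (symmDeriv E a x).inverse ∘L leftDeriv ((extChartAt 𝓘(ℝ, E) a).symm x)

variable [LieGroup 𝓘(ℝ, E) ∞ H]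

theorem isInvertible_leftDeriv (h : H) : (leftDeriv (E := E) h).IsInvertible := by
  have hd : ∀ g x : H, MDifferentiableAt 𝓘(ℝ, E) 𝓘(ℝ, E) (fun x : H => g * x) x := fun g x =>
    (contMDiff_mul_left (I := 𝓘(ℝ, E)) (n := ∞)).contMDiffAt.mdifferentiableAt (by simp)
  let T : H → H → E →L[ℝ] E := fun g x => mfderiv 𝓘(ℝ, E) 𝓘(ℝ, E) (fun x : H => g * x) x
  have key : ∀ g g' x : H, g' * g = 1 →
      T g' (g * x) ∘L T g x = ContinuousLinearMap.id ℝ E := fun g g' x hg => by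
    have h1 := mfderiv_comp x (I := 𝓘(ℝ, E)) (I' := 𝓘(ℝ, E)) (I'' := 𝓘(ℝ, E)) (hd g' (g * x))
      (hd g x)
    have h2 : (fun x : H => g' * x) ∘ (fun x : H => g * x) = id := by
      funext y
      simp [← mul_assoc, hg]
    rw [h2, mfderiv_id] at h1
    exact h1.symm
  have h1 := key h h⁻¹ 1 (inv_mul_cancel h)
  have h2 := key h⁻¹ h (h * 1) (mul_inv_cancel h)
  rw [mul_one, inv_mul_cancel] at h2
  rw [mul_one] at h1
  exact ⟨ContinuousLinearEquiv.equivOfInverse' _ _ h2 h1, rfl⟩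

theorem leftDeriv_mcForm (σ : F → H) (u v : F) :
    leftDeriv (σ u) (mcForm E σ u v) = derivTo E σ u v := by
  obtain ⟨e, he⟩ := isInvertible_leftDeriv (E := E) (σ u)
  rw [mcForm, ← he]
  simp

variable [CompleteSpace E]

/-- The Lie bracket of the Lie algebra of `H`, as an operation on the model space. -/
def modelBracket (E : Type*) [NormedAddCommGroup E] [NormedSpace ℝ E] [CompleteSpace E]
    (H : Type*) [TopologicalSpace H] [ChartedSpace E H] [Group H] [LieGroup 𝓘(ℝ, E) ∞ H]
    (X Y : E) : E :=
  @Bracket.bracket (LieAlg E H) (LieAlg E H) _ X Y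

theorem isInvertible_symmDeriv {a : H} {x : E} (hx : x ∈ (extChartAt 𝓘(ℝ, E) a).target) :
    (symmDeriv E a x).IsInvertible := by
  have := isInvertible_mfderivWithin_extChartAt_symm (I := 𝓘(ℝ, E)) hx
  simp only [modelWithCornersSelf_coe, Set.range_id, mfderivWithin_univ] at this
  exact this

theorem contDiffAt_chartField_apply (a : H) (X : LieAlg E H) :
    ContDiffAt ℝ 2 (fun x => chartField E a x X) (extChartAt 𝓘(ℝ, E) a a) := by
  have h := contMDiffAt_mulInvariantVectorField (I := 𝓘(ℝ, E)) X (g := a)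
  replace h := h.of_le (m := 2) le_minSmoothness
  have h1 := contMDiffWithinAt_mpullbackWithin_extChartAt_symm (I := 𝓘(ℝ, E)) (n := 3)
    h.contMDiffWithinAt uniqueMDiffOn_univ (Set.mem_univ a) (by norm_num)
  have h2 := h1.contMDiffAt (by
    simpa using extChartAt_target_mem_nhds (I := 𝓘(ℝ, E)) a)
  simp only [modelWithCornersSelf_coe, Set.range_id, mpullbackWithin_univ] at h2
  exact contMDiffAt_vectorSpace_iff_contDiffAt.1 h2

/-- Left-invariant fields are closed under the bracket. The statement is at the centre of the chart,
where the manifold bracket is by definition computed in that chart; the Maurer-Cartan equation at u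
will use the chart centred at σ(u). -/
theorem lieBracket_chartField (a : H) (X Y : E) :
    lieBracket ℝ (fun x => chartField E a x X) (fun x => chartField E a x Y)
      (extChartAt 𝓘(ℝ, E) a a) = chartField E a (extChartAt 𝓘(ℝ, E) a a) (modelBracket E H X Y) := by
  have h0 := mlieBracketWithin_apply (I := 𝓘(ℝ, E)) (V := mulInvariantVectorField (G := H) X)
    (W := mulInvariantVectorField (G := H) Y) (s := Set.univ) (x₀ := a)
  simp only [mlieBracketWithin_univ, modelWithCornersSelf_coe, Set.range_id, mpullbackWithin_univ,
    Set.preimage_univ, Set.inter_univ] at h0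
  have h := (congrFun (mulInvariantVector_mlieBracket (I := 𝓘(ℝ, E)) (G := H) X Y) a).trans h0
  let A : E →L[ℝ] E := mfderiv 𝓘(ℝ, E) 𝓘(ℝ, E) (extChartAt 𝓘(ℝ, E) a) a
  have hx := mem_extChartAt_target (I := 𝓘(ℝ, E)) a
  have hA : A.IsInvertible :=
    isInvertible_mfderiv_extChartAt (I := 𝓘(ℝ, E)) (mem_extChartAt_source (I := 𝓘(ℝ, E)) a)
  have h' : leftDeriv a (modelBracket E H X Y) = A.inverse (lieBracketWithin ℝ (E := E)
    (fun x => chartField E a x X) (fun x => chartField E a x Y) Set.univ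
      (extChartAt 𝓘(ℝ, E) a a)) := h
  have hS := isInvertible_symmDeriv hx
  have hc : symmDeriv E a (extChartAt 𝓘(ℝ, E) a a) ∘L A = ContinuousLinearMap.id ℝ E := by
    have := mfderivWithin_extChartAt_symm_comp_mfderiv_extChartAt' (I := 𝓘(ℝ, E))
      (mem_extChartAt_source (I := 𝓘(ℝ, E)) a)
    simp only [modelWithCornersSelf_coe, Set.range_id, mfderivWithin_univ] at this
    exact this
  rw [lieBracketWithin_univ, eq_comm, hA.inverse_apply_eq] at h'
  rw [h', chartField, extChartAt_to_inv, ContinuousLinearMap.comp_apply, eq_comm,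
    hS.inverse_apply_eq]
  exact (congrArg (fun B => B (leftDeriv a (modelBracket E H X Y))) hc).symm

/-- The velocity of σ is the value at σ(u) of the left-invariant field with parameter η(w). In the
chart this reads A(s)η = ds, with s the coordinate expression of σ; regularity and the structure
equation of η both follow from it. -/
theorem chartField_mcForm {σ : F → H} {u : F} (a : H) (hσ : ContMDiffAt 𝓘(ℝ, F) 𝓘(ℝ, E) ∞ σ u)
    (ha : σ u ∈ (extChartAt 𝓘(ℝ, E) a).source) (w : F) :
    chartField E a (extChartAt 𝓘(ℝ, E) a (σ u)) (mcForm E σ u w) =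
      fderiv ℝ (fun x => extChartAt 𝓘(ℝ, E) a (σ x)) u w := by
  have hx := (extChartAt 𝓘(ℝ, E) a).map_source ha
  have hinv := isInvertible_symmDeriv hx
  have e : (extChartAt 𝓘(ℝ, E) a).symm (extChartAt 𝓘(ℝ, E) a (σ u)) = σ u :=
    (extChartAt 𝓘(ℝ, E) a).left_inv ha
  have h1 : leftDeriv ((extChartAt 𝓘(ℝ, E) a).symm (extChartAt 𝓘(ℝ, E) a (σ u)))
      (mcForm E σ u w) = derivTo E σ u w := by
    rw [e, leftDeriv_mcForm]
  rw [chartField, ContinuousLinearMap.comp_apply, h1, hinv.inverse_apply_eq]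
  have hs : DifferentiableAt ℝ (fun x => extChartAt 𝓘(ℝ, E) a (σ x)) u := by
    rw [extChartAt_source] at ha
    exact (contMDiffAt_iff_contDiffAt.1 ((contMDiffAt_extChartAt' (n := ∞) ha).comp u
      hσ)).differentiableAt (by simp)
  have h2 : MDifferentiableAt 𝓘(ℝ, E) 𝓘(ℝ, E) (extChartAt 𝓘(ℝ, E) a).symm
      (extChartAt 𝓘(ℝ, E) a (σ u)) :=
    ((contMDiffOn_extChartAt_symm (n := ∞) a).contMDiffAt
      ((isOpen_extChartAt_target a).mem_nhds hx)).mdifferentiableAt (by simp)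
  have h3 := mfderiv_comp u (I := 𝓘(ℝ, F)) (I' := 𝓘(ℝ, E)) (I'' := 𝓘(ℝ, E)) h2
    hs.mdifferentiableAt
  have h4 : (extChartAt 𝓘(ℝ, E) a).symm ∘ (fun x => extChartAt 𝓘(ℝ, E) a (σ x)) =ᶠ[𝓝 u] σ := by
    filter_upwards [hσ.continuousAt.preimage_mem_nhds
      ((isOpen_extChartAt_source a).mem_nhds ha)] with x hx
    exact (extChartAt 𝓘(ℝ, E) a).left_inv hx
  rw [h4.mfderiv_eq, mfderiv_eq_fderiv] at h3
  exact congrArg (fun B : F →L[ℝ] E => B w) h3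

variable [FiniteDimensional ℝ E]

theorem contDiffAt_chartField (a : H) :
    ContDiffAt ℝ 2 (chartField E a) (extChartAt 𝓘(ℝ, E) a a) :=
  contDiffAt_clm_of_apply fun X => contDiffAt_chartField_apply a X

theorem isInvertible_chartField {a : H} {x : E} (hx : x ∈ (extChartAt 𝓘(ℝ, E) a).target) :
    (chartField E a x).IsInvertible :=
  (isInvertible_symmDeriv hx).inverse.comp (isInvertible_leftDeriv _)

theorem contDiffAt_extChartAt_comp {σ : F → H} {u : F}
    (hσ : ContMDiffAt 𝓘(ℝ, F) 𝓘(ℝ, E) ∞ σ u) :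
    ContDiffAt ℝ ∞ (fun x => extChartAt 𝓘(ℝ, E) (σ u) (σ x)) u :=
  contMDiffAt_iff_contDiffAt.1 (contMDiffAt_extChartAt.comp u hσ)

theorem eventually_chartField_mcForm {σ : F → H} {u : F}
    (hσ : ∀ᶠ x in 𝓝 u, ContMDiffAt 𝓘(ℝ, F) 𝓘(ℝ, E) ∞ σ x) :
    ∀ᶠ x in 𝓝 u, ∀ w, chartField E (σ u) (extChartAt 𝓘(ℝ, E) (σ u) (σ x)) (mcForm E σ x w) =
      fderiv ℝ (fun x => extChartAt 𝓘(ℝ, E) (σ u) (σ x)) x w := by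
  filter_upwards [hσ, hσ.self_of_nhds.continuousAt.preimage_mem_nhds
    (extChartAt_source_mem_nhds (I := 𝓘(ℝ, E)) (σ u))] with x h1 h2 w
  exact chartField_mcForm _ h1 h2 w

theorem contDiffAt_mcForm {σ : F → H} {u : F}
    (hσ : ∀ᶠ x in 𝓝 u, ContMDiffAt 𝓘(ℝ, F) 𝓘(ℝ, E) ∞ σ x) :
    ContDiffAt ℝ 2 (mcForm E σ) u := by
  have hs := contDiffAt_extChartAt_comp hσ.self_of_nhds
  have hV : ContDiffAt ℝ 2 (fun x => (chartField E (σ u)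
      (extChartAt 𝓘(ℝ, E) (σ u) (σ x))).inverse) u := by
    have h1 := (contDiffAt_chartField (E := E) (σ u)).comp u (hs.of_le (m := 2) (by norm_cast))
    exact ((isInvertible_chartField (mem_extChartAt_target (σ u))).contDiffAt_map_inverse).comp u h1
  have h2 : mcForm E σ =ᶠ[𝓝 u] fun x => (chartField E (σ u)
      (extChartAt 𝓘(ℝ, E) (σ u) (σ x))).inverse ∘L
        fderiv ℝ (fun x => extChartAt 𝓘(ℝ, E) (σ u) (σ x)) x := by
    filter_upwards [eventually_chartField_mcForm hσ,
      hσ.self_of_nhds.continuousAt.preimage_mem_nhds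
        (extChartAt_source_mem_nhds (I := 𝓘(ℝ, E)) (σ u))] with x h1 h2
    ext w
    rw [ContinuousLinearMap.comp_apply, ← h1, eq_comm, (isInvertible_chartField
      ((extChartAt 𝓘(ℝ, E) (σ u)).map_source h2)).inverse_apply_eq]
  refine ContDiffAt.congr_of_eventuallyEq ?_ h2
  exact hV.clm_comp (hs.fderiv_right (m := 2) (by norm_cast))

/-- The Maurer-Cartan equation. -/
theorem maurerCartan {σ : F → H} {u : F}
    (hσ : ∀ᶠ x in 𝓝 u, ContMDiffAt 𝓘(ℝ, F) 𝓘(ℝ, E) ∞ σ x) (v w : F) :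
    fderiv ℝ (mcForm E σ) u v w - fderiv ℝ (mcForm E σ) u w v =
      -modelBracket E H (mcForm E σ u v) (mcForm E σ u w) := by
  have hs := contDiffAt_extChartAt_comp hσ.self_of_nhds
  set s := fun x => extChartAt 𝓘(ℝ, E) (σ u) (σ x) with hs_def
  set A := chartField E (σ u) with hA
  have hV : HasFDerivAt A (fderiv ℝ A (s u)) (s u) :=
    ((contDiffAt_chartField (E := E) (σ u)).differentiableAt (by simp)).hasFDerivAt
  have hη := ((contDiffAt_mcForm hσ).differentiableAt (by simp)).hasFDerivAt
  have hsd := (hs.differentiableAt (by simp)).hasFDerivAt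
  have hs2 := ((hs.fderiv_right (m := 1) (by norm_cast)).differentiableAt (by simp)).hasFDerivAt
  have hfield := eventually_chartField_mcForm hσ
  -- The derivative of A(s)η(w) = ∂_w s in the direction v. Antisymmetrising in v and w removes the
  -- second derivative of s.
  have key : ∀ v w, fderiv ℝ A (s u) (fderiv ℝ s u v) (mcForm E σ u w) +
      A (s u) (fderiv ℝ (mcForm E σ) u v w) = fderiv ℝ (fderiv ℝ s) u v w := fun v w => by
    have h1 := (hV.comp u hsd).clm_apply (hη.clm_apply (hasFDerivAt_const w u))
    have h2 : HasFDerivAt (fun x => fderiv ℝ s x w) _ u :=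
      hs2.clm_apply (hasFDerivAt_const w u)
    have h3 := h2.congr_of_eventuallyEq (hfield.mono fun x hx => hx w)
    have := congrArg (fun B => B v) (h1.unique h3)
    simpa [add_comm] using this
  have hsymm : fderiv ℝ (fderiv ℝ s) u v w = fderiv ℝ (fderiv ℝ s) u w v :=
    (hs.of_le (m := 2) (by norm_cast)).isSymmSndFDerivAt (by simp) v w
  have hb := lieBracket_chartField (E := E) (σ u) (mcForm E σ u v) (mcForm E σ u w)
  have hf : ∀ X : E, HasFDerivAt (fun x => A x X) ((fderiv ℝ A (s u)).flip X) (s u) := fun X => by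
    simpa using hV.clm_apply (hasFDerivAt_const X (s u))
  have hu := hfield.self_of_nhds
  obtain ⟨e, he⟩ := isInvertible_chartField (E := E) (mem_extChartAt_target (σ u))
  have he' : ∀ x, A (s u) x = e x := fun x => congrArg (fun B => B x) he.symm
  apply e.injective
  rw [← he', ← he', map_sub, map_neg]
  -- Since ds = A(s)η, the antisymmetrised derivative of A is the Lie bracket of two left-invariant
  -- fields.
  have hb' : fderiv ℝ A (s u) (fderiv ℝ s u v) (mcForm E σ u w) -
      fderiv ℝ A (s u) (fderiv ℝ s u w) (mcForm E σ u v) =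
      A (s u) (modelBracket E H (mcForm E σ u v) (mcForm E σ u w)) := by
    rw [← hu v, ← hu w]
    refine Eq.trans ?_ hb
    have e1 := (hf (mcForm E σ u w)).fderiv
    have e2 := (hf (mcForm E σ u v)).fderiv
    change _ = fderiv ℝ (fun x => A x (mcForm E σ u w)) (s u) (A (s u) (mcForm E σ u v)) -
      fderiv ℝ (fun x => A x (mcForm E σ u v)) (s u) (A (s u) (mcForm E σ u w))
    rw [e1, e2]
    rfl
  have k1 := key v w
  have k2 := key w v
  rw [hsymm] at k1
  rw [← hb', eq_sub_of_add_eq' k1, eq_sub_of_add_eq' k2]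
  abel

end MaurerCartan

/-! ### Local sections and fibre curves of submersions -/

section Submersion

variable {E E' : Type*} [NormedAddCommGroup E] [NormedSpace ℝ E] [NormedAddCommGroup E']
  [NormedSpace ℝ E'] {B B' : Type*} [TopologicalSpace B] [TopologicalSpace B']
  {I : ModelWithCorners ℝ E B} {J : ModelWithCorners ℝ E' B'} [I.Boundaryless] [J.Boundaryless]
  {M N : Type*} [TopologicalSpace M] [ChartedSpace B M] [TopologicalSpace N] [ChartedSpace B' N]

theorem eventually_contMDiffAt_extend {φ : OpenPartialHomeomorph M B}
    (hφ : φ ∈ IsManifold.maximalAtlas I ∞ M) {x : M} (hx : x ∈ φ.source) :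
    ∀ᶠ y in 𝓝 x, y ∈ φ.source ∧ ContMDiffAt I 𝓘(ℝ, E) ∞ (φ.extend I) y := by
  filter_upwards [φ.open_source.mem_nhds hx] with y hy
  exact ⟨hy, (φ.contMDiffOn_extend hφ).contMDiffAt (φ.open_source.mem_nhds hy)⟩

theorem eventually_contMDiffAt_extend_symm {φ : OpenPartialHomeomorph M B}
    (hφ : φ ∈ IsManifold.maximalAtlas I ∞ M) {z : E} (hz : z ∈ (φ.extend I).target) :
    ∀ᶠ y in 𝓝 z, y ∈ (φ.extend I).target ∧ ContMDiffAt 𝓘(ℝ, E) I ∞ (φ.extend I).symm y := by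
  filter_upwards [φ.isOpen_extend_target.mem_nhds hz] with y hy
  refine ⟨hy, ?_⟩
  have h := contMDiffOn_extend_symm (I := I) hφ
  rw [← φ.extend_target'] at h
  exact h.contMDiffAt (φ.isOpen_extend_target.mem_nhds hy)

variable {f : M → N} {x : M}

/-- A submersion has smooth local sections. -/
theorem exists_local_section {C : Type*} [NormedAddCommGroup C] [NormedSpace ℝ C]
    (hf : IsSubmersionAtOfComplement C I J ∞ f x) :
    ∃ s : N → M, s (f x) = x ∧ (∀ᶠ y in 𝓝 (f x), ContMDiffAt J I ∞ s y) ∧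
      ∀ᶠ y in 𝓝 (f x), f (s y) = y := by
  have hxs := hf.mem_domChart_source
  have hys := hf.mem_codChart_source
  set φ := hf.domChart
  set ψ := hf.codChart
  set e := hf.equiv
  have hw : ∀ z ∈ (φ.extend I).target, ψ.extend J (f ((φ.extend I).symm z)) = (e z).1 :=
    fun z hz => hf.writtenInCharts hz
  have hxt : φ.extend I x ∈ (φ.extend I).target :=
    (φ.extend I).map_source (by rwa [φ.extend_source])
  -- In adapted charts the submersion is the first projection; the section freezes the complementary
  -- coordinate at its value at x.
  let i : E' → E := fun z => e.symm (z, (e (φ.extend I x)).2)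
  have hi : ContDiff ℝ ∞ i := e.symm.contDiff.comp (contDiff_id.prodMk contDiff_const)
  have hi0 : i (ψ.extend J (f x)) = φ.extend I x := by
    have h1 := hw _ hxt
    rw [φ.extend_left_inv hxs] at h1
    simp only [i, h1, Prod.mk.eta, ContinuousLinearEquiv.symm_apply_apply]
  have hΨ := eventually_contMDiffAt_extend hf.codChart_mem_maximalAtlas hys
  have hc : Tendsto (fun y => i (ψ.extend J y)) (𝓝 (f x)) (𝓝 (φ.extend I x)) := by
    have : ContinuousAt (fun y => i (ψ.extend J y)) (f x) :=
      hi.continuous.continuousAt.comp hΨ.self_of_nhds.2.continuousAt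
    rw [ContinuousAt, hi0] at this
    exact this
  have hΦ := hc.eventually
    (eventually_contMDiffAt_extend_symm hf.domChart_mem_maximalAtlas hxt)
  refine ⟨fun y => (φ.extend I).symm (i (ψ.extend J y)), ?_, ?_, ?_⟩
  · beta_reduce
    rw [hi0, φ.extend_left_inv hxs]
  · filter_upwards [hΨ, hΦ] with y h1 h2
    exact h2.2.comp y (hi.contMDiff.contMDiffAt.comp y h1.2)
  · filter_upwards [hΨ, hΦ] with y h1 h2
    have h3 := hw _ h2.1
    simp only [i, ContinuousLinearEquiv.apply_symm_apply] at h3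
    have h4 : f ((φ.extend I).symm (i (ψ.extend J y))) ∈ ψ.source :=
      hf.source_subset_preimage_source (by
        have := (φ.extend I).map_target h2.1
        rwa [φ.extend_source] at this)
    rw [← ψ.extend_left_inv h4 (I := J), ← ψ.extend_left_inv h1.1 (I := J)]
    congr 1
    rw [ψ.extend_left_inv h1.1 (I := J)]
    exact h3

/-- The vectors in the kernel of the differential of a submersion are the velocities of curves in
the fibre. -/
theorem exists_curve_of_mfderiv_eq_zero {C : Type*} [NormedAddCommGroup C] [NormedSpace ℝ C]
    (hf : IsSubmersionAtOfComplement C I J ∞ f x) (v : E)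
    (hv : mfderiv I J f x v = (0 : E')) :
    ∃ γ : ℝ → M, γ 0 = x ∧ (∀ t, f (γ t) = f x) ∧
      HasMFDerivAt 𝓘(ℝ, ℝ) I γ 0 (ContinuousLinearMap.toSpanSingleton ℝ v) := by
  have hxs := hf.mem_domChart_source
  have hys := hf.mem_codChart_source
  have hfx : MDifferentiableAt I J f x := hf.contMDiffAt.mdifferentiableAt (by simp)
  set φ := hf.domChart
  set ψ := hf.codChart
  set e := hf.equiv
  have hw : ∀ z ∈ (φ.extend I).target, ψ.extend J (f ((φ.extend I).symm z)) = (e z).1 :=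
    fun z hz => hf.writtenInCharts hz
  have hxt : φ.extend I x ∈ (φ.extend I).target :=
    (φ.extend I).map_source (by rwa [φ.extend_source])
  have hΦ := eventually_contMDiffAt_extend (I := I) hf.domChart_mem_maximalAtlas hxs
  have hΨ := eventually_contMDiffAt_extend (I := J) hf.codChart_mem_maximalAtlas hys
  have hΦs := eventually_contMDiffAt_extend_symm hf.domChart_mem_maximalAtlas hxt
  have hΦd := (hΦ.self_of_nhds.2.mdifferentiableAt (by simp)).hasMFDerivAt
  have hΨd := (hΨ.self_of_nhds.2.mdifferentiableAt (by simp)).hasMFDerivAt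
  have hΦsd := (hΦs.self_of_nhds.2.mdifferentiableAt (by simp)).hasMFDerivAt
  -- In the adapted chart v becomes A, whose first component represents df(v) = 0. The straight line
  -- along A therefore stays in the fibre for small t.
  let A : E := mfderiv I 𝓘(ℝ, E) (φ.extend I) x v
  have hA : (e A).1 = 0 := by
    have h1 := hΨd.comp x hfx.hasMFDerivAt
    have h2 := (((ContinuousLinearMap.fst ℝ E' C).comp
      (e : E →L[ℝ] E' × C)).hasMFDerivAt (x := φ.extend I x)).comp x hΦd
    have h3 : ψ.extend J ∘ f =ᶠ[𝓝 x] ((ContinuousLinearMap.fst ℝ E' C).comp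
      (e : E →L[ℝ] E' × C)) ∘ φ.extend I := by
      filter_upwards [hΦ] with y hy
      have := hw (φ.extend I y) ((φ.extend I).map_source (by rw [φ.extend_source]; exact hy.1))
      rw [φ.extend_left_inv hy.1] at this
      exact this
    have h4 := hasMFDerivAt_unique (h2.congr_of_eventuallyEq h3) h1
    have h5 : (e A).1 = mfderiv J 𝓘(ℝ, E') (ψ.extend J) (f x) (mfderiv I J f x v) :=
      congrArg (fun L : E →L[ℝ] E' => L v) h4
    rw [h5, hv]
    exact map_zero _
  let c : ℝ → E := fun t => φ.extend I x + t • A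
  have hc0 : c 0 = φ.extend I x := by simp [c]
  have hc : HasFDerivAt c (ContinuousLinearMap.toSpanSingleton ℝ A) 0 := by
    have := ((hasDerivAt_id (0 : ℝ)).smul_const A).const_add (φ.extend I x)
    rw [one_smul] at this
    exact this.hasFDerivAt
  let γ₀ : ℝ → M := fun t => (φ.extend I).symm (c t)
  have hγ₀ : γ₀ 0 = x := by
    simp only [γ₀, hc0]
    exact φ.extend_left_inv hxs
  have hfib : ∀ᶠ t in 𝓝 (0 : ℝ), f (γ₀ t) = f x := by
    have h1 := hc.continuousAt.eventually (by rw [hc0]; exact hΦs)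
    filter_upwards [h1] with t ht
    have h2 := hw _ ht.1
    have h3 := hw _ hxt
    rw [φ.extend_left_inv hxs] at h3
    have h4 : (e (c t)).1 = (e (φ.extend I x)).1 := by
      simp [c, hA]
    have h5 : f (γ₀ t) ∈ ψ.source := hf.source_subset_preimage_source (by
      have := (φ.extend I).map_target ht.1
      rwa [φ.extend_source] at this)
    rw [← ψ.extend_left_inv h5 (I := J), ← ψ.extend_left_inv hys (I := J), h3, ← h4, ← h2]
  have hd : HasMFDerivAt 𝓘(ℝ, ℝ) I γ₀ 0 (ContinuousLinearMap.toSpanSingleton ℝ v) := by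
    have h1 : HasMFDerivAt 𝓘(ℝ, E) I (φ.extend I).symm (c 0)
      (mfderiv 𝓘(ℝ, E) I (φ.extend I).symm (φ.extend I x) : E →L[ℝ] E) := by
      rw [hc0]; exact hΦsd
    have h2 := h1.comp (0 : ℝ) hc.hasMFDerivAt
    have h3 := HasMFDerivAt.comp x hΦsd hΦd
    have h4 : (φ.extend I).symm ∘ φ.extend I =ᶠ[𝓝 x] id := by
      filter_upwards [hΦ] with y hy using φ.extend_left_inv hy.1
    have h5 := hasMFDerivAt_unique ((hasMFDerivAt_id x).congr_of_eventuallyEq h4) h3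
    have h6 : v = (mfderiv 𝓘(ℝ, E) I (φ.extend I).symm (φ.extend I x) : E →L[ℝ] E) A :=
      congrArg (fun L : E →L[ℝ] E => L v) h5
    have h7 : (mfderiv 𝓘(ℝ, E) I (φ.extend I).symm (φ.extend I x) : E →L[ℝ] E).comp
        (ContinuousLinearMap.toSpanSingleton ℝ A) = ContinuousLinearMap.toSpanSingleton ℝ v := by
      ext
      change (mfderiv 𝓘(ℝ, E) I (φ.extend I).symm (φ.extend I x) : E →L[ℝ] E) ((1 : ℝ) • A) =
        (1 : ℝ) • v
      rw [one_smul, one_smul]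
      exact h6.symm
    have h8 : ∀ L : ℝ →L[ℝ] E, (mfderiv 𝓘(ℝ, E) I (φ.extend I).symm (φ.extend I x) :
        E →L[ℝ] E).comp (ContinuousLinearMap.toSpanSingleton ℝ A) = L →
        HasMFDerivAt 𝓘(ℝ, ℝ) I γ₀ 0 L := by
      rintro _ rfl
      exact h2
    exact h8 _ h7
  classical
  -- The line may leave the chart; the curve is reset to x wherever it is off the fibre. This
  -- changes nothing near 0.
  refine ⟨fun t => if f (γ₀ t) = f x then γ₀ t else x, by simp [hγ₀], fun t => ?_, ?_⟩
  · beta_reduce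
    split_ifs with h
    · exact h
    · rfl
  · have h0 : (fun t => if f (γ₀ t) = f x then γ₀ t else x) =ᶠ[𝓝 0] γ₀ := by
      filter_upwards [hfib] with t ht using if_pos ht
    exact hd.congr_of_eventuallyEq h0

end Submersion

/-! ### The projection of H × H onto the homogeneous space -/

section Quotient

variable {E : Type*} [NormedAddCommGroup E] [NormedSpace ℝ E]
  {H : Type*} [TopologicalSpace H] [ChartedSpace E H] [Group H]
  {F : Type*} [NormedAddCommGroup F] [NormedSpace ℝ F]

/-- The projection `H × H → (H × H) / ΔK`. -/
def proj (K : Subgroup H) (a : H × H) : DiagQuotient K := QuotientGroup.mk a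

theorem smul_proj (K : Subgroup H) (a b : H × H) : a • proj K b = proj K (a * b) := rfl

theorem exists_proj_eq (K : Subgroup H) (p : DiagQuotient K) : ∃ a, proj K a = p :=
  QuotientGroup.mk_surjective p

theorem proj_eq_proj_one_iff (K : Subgroup H) (a : H × H) :
    proj K a = proj K 1 ↔ a.1 ∈ K ∧ a.2 = a.1 := by
  rw [eq_comm, proj, proj, QuotientGroup.eq, inv_one, one_mul, diagSubgroup, Subgroup.mem_map]
  constructor
  · rintro ⟨k, hk, rfl⟩
    exact ⟨hk, rfl⟩
  · rintro ⟨h1, h2⟩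
    exact ⟨a.1, h1, Prod.ext rfl h2.symm⟩

/-- The differential of the projection at the identity. -/
def projDeriv (E F : Type*) [NormedAddCommGroup E] [NormedSpace ℝ E] [NormedAddCommGroup F]
    [NormedSpace ℝ F] {H : Type*} [TopologicalSpace H] [ChartedSpace E H] [Group H]
    (K : Subgroup H) [ChartedSpace F (DiagQuotient K)] : E × E →L[ℝ] F :=
  mfderiv (𝓘(ℝ, E).prod 𝓘(ℝ, E)) 𝓘(ℝ, F) (proj K) 1

/-- The differential at the base point of the action of `a`. -/
def smulDeriv (F : Type*) [NormedAddCommGroup F] [NormedSpace ℝ F] {H : Type*}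
    [TopologicalSpace H] [Group H] (K : Subgroup H) [ChartedSpace F (DiagQuotient K)]
    (a : H × H) : F →L[ℝ] F :=
  mfderiv 𝓘(ℝ, F) 𝓘(ℝ, F) (fun r : DiagQuotient K => a • r) (proj K 1)

theorem contMDiff_mul_left_prod [LieGroup 𝓘(ℝ, E) ∞ H] (a : H × H) :
    ContMDiff (𝓘(ℝ, E).prod 𝓘(ℝ, E)) (𝓘(ℝ, E).prod 𝓘(ℝ, E)) ∞ (fun x : H × H => a * x) :=
  (contMDiff_mul_left (a := a.1)).prodMap (contMDiff_mul_left (a := a.2))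

variable {K : Subgroup H} [ChartedSpace F (DiagQuotient K)] (hM : IsStandardSmoothStructure E F K)
include hM

theorem contMDiff_proj : ContMDiff (𝓘(ℝ, E).prod 𝓘(ℝ, E)) 𝓘(ℝ, F) ∞ (proj K) :=
  IsSubmersion.contMDiff hM

theorem exists_section_proj (a : H × H) : ∃ s : DiagQuotient K → H × H, s (proj K a) = a ∧
    (∀ᶠ y in 𝓝 (proj K a), ContMDiffAt 𝓘(ℝ, F) (𝓘(ℝ, E).prod 𝓘(ℝ, E)) ∞ s y) ∧
      ∀ᶠ y in 𝓝 (proj K a), proj K (s y) = y := by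
  obtain ⟨C, _, _, hC⟩ := hM
  exact exists_local_section (hC a)

/-- Differentiate π ∘ s = id for a local section s. -/
theorem projDeriv_surjective : Function.Surjective (projDeriv E F K) := by
  intro v
  obtain ⟨s, h1, h2, h3⟩ := exists_section_proj hM 1
  have hs := (h2.self_of_nhds.mdifferentiableAt (by simp)).hasMFDerivAt
  have hp : HasMFDerivAt (𝓘(ℝ, E).prod 𝓘(ℝ, E)) 𝓘(ℝ, F) (proj K) (s (proj K 1))
      (projDeriv E F K) := by
    rw [h1]
    exact ((contMDiff_proj hM).contMDiffAt.mdifferentiableAt (by simp)).hasMFDerivAt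
  have h4 : proj K ∘ s =ᶠ[𝓝 (proj K 1)] id := h3
  have h5 := hasMFDerivAt_unique ((hasMFDerivAt_id (proj K 1)).congr_of_eventuallyEq h4)
    (hp.comp _ hs)
  exact ⟨_, (congrArg (fun L : F →L[ℝ] F => L v) h5).symm⟩

variable [LieGroup 𝓘(ℝ, E) ∞ H]

/-- The isotropy algebra is the diagonal of 𝔨. A kernel vector is the velocity of a curve in the
fibre ΔK, hence of a pair of equal curves in K; conversely the projection is constant along (γ, γ).
-/
theorem projDeriv_eq_zero_iff (X Y : E) :
    projDeriv E F K (X, Y) = 0 ↔ X ∈ subgroupLieAlg E K ∧ Y = X := by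
  constructor
  · intro h
    obtain ⟨C, _, _, hC⟩ := hM
    obtain ⟨γ, h0, hf, hγ⟩ := exists_curve_of_mfderiv_eq_zero (hC 1) ((X, Y) : E × E) h
    have hf' : ∀ t, (γ t).1 ∈ K ∧ (γ t).2 = (γ t).1 := fun t =>
      (proj_eq_proj_one_iff K (γ t)).1 (hf t)
    have h1 : HasMFDerivAt 𝓘(ℝ, ℝ) 𝓘(ℝ, E) (fun t => (γ t).1) 0
        (ContinuousLinearMap.toSpanSingleton ℝ X) := by
      have := (hasMFDerivAt_fst (I := 𝓘(ℝ, E)) (I' := 𝓘(ℝ, E)) (γ 0)).comp (0 : ℝ) hγ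
      have e : (ContinuousLinearMap.fst ℝ E E).comp
          (ContinuousLinearMap.toSpanSingleton ℝ ((X, Y) : E × E)) =
          ContinuousLinearMap.toSpanSingleton ℝ X := by ext; simp
      exact e ▸ this
    have h2 : HasMFDerivAt 𝓘(ℝ, ℝ) 𝓘(ℝ, E) (fun t => (γ t).2) 0
        (ContinuousLinearMap.toSpanSingleton ℝ Y) := by
      have := (hasMFDerivAt_snd (I := 𝓘(ℝ, E)) (I' := 𝓘(ℝ, E)) (γ 0)).comp (0 : ℝ) hγ
      have e : (ContinuousLinearMap.snd ℝ E E).comp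
          (ContinuousLinearMap.toSpanSingleton ℝ ((X, Y) : E × E)) =
          ContinuousLinearMap.toSpanSingleton ℝ Y := by ext; simp
      exact e ▸ this
    refine ⟨⟨fun t => (γ t).1, fun t => (hf' t).1, by beta_reduce; rw [h0]; rfl, h1⟩, ?_⟩
    have h3 : (fun t => (γ t).2) = fun t => (γ t).1 := funext fun t => (hf' t).2
    have h4 : ∀ δ : ℝ → H, δ = (fun t => (γ t).1) → HasMFDerivAt 𝓘(ℝ, ℝ) 𝓘(ℝ, E) δ 0
        (ContinuousLinearMap.toSpanSingleton ℝ Y) → X = Y := by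
      rintro _ rfl h
      have := congrArg (fun L : ℝ →L[ℝ] E => L 1) (hasMFDerivAt_unique h1 h)
      exact (one_smul ℝ X).symm.trans (this.trans (one_smul ℝ Y))
    exact (h4 _ h3 h2).symm
  · rintro ⟨⟨γ, hγK, hγ0, hγ⟩, rfl⟩
    have h1 := hγ.prodMk hγ
    have h2 : HasMFDerivAt (𝓘(ℝ, E).prod 𝓘(ℝ, E)) 𝓘(ℝ, F) (proj K) (γ 0, γ 0)
        (projDeriv E F K) := by
      rw [hγ0]
      exact ((contMDiff_proj hM).contMDiffAt.mdifferentiableAt (by simp)).hasMFDerivAt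
    have h3 := HasMFDerivAt.comp (0 : ℝ) h2 h1
    have h4 : proj K ∘ (fun t => (γ t, γ t)) = fun _ => proj K 1 :=
      funext fun t => (proj_eq_proj_one_iff K _).2 ⟨hγK t, rfl⟩
    have h5 : ∀ δ : ℝ → DiagQuotient K, δ = (fun _ => proj K 1) → ∀ L : ℝ →L[ℝ] F,
        HasMFDerivAt 𝓘(ℝ, ℝ) 𝓘(ℝ, F) δ 0 L → L = 0 := by
      rintro _ rfl L h
      exact hasMFDerivAt_unique h (hasMFDerivAt_const _ _)
    have h6 := congrArg (fun L : ℝ →L[ℝ] F => L 1) (h5 _ h4 _ h3)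
    have h7 : projDeriv E F K ((1 : ℝ) • Y, (1 : ℝ) • Y) = 0 := h6
    rwa [one_smul] at h7

/-- Locally the action of a is π ∘ L_a ∘ s with s a smooth section. -/
theorem contMDiff_smul_quotient (a : H × H) :
    ContMDiff 𝓘(ℝ, F) 𝓘(ℝ, F) ∞ (fun r : DiagQuotient K => a • r) := by
  intro r
  obtain ⟨b, rfl⟩ := exists_proj_eq K r
  obtain ⟨s, h1, h2, h3⟩ := exists_section_proj hM b
  have h4 : (fun r : DiagQuotient K => a • r) =ᶠ[𝓝 (proj K b)]
      proj K ∘ (fun x => a * x) ∘ s := by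
    filter_upwards [h3] with y hy
    simp only [Function.comp_apply, ← smul_proj, hy]
  exact (((contMDiff_proj hM).contMDiffAt).comp _
    ((contMDiff_mul_left_prod (E := E) a).contMDiffAt.comp _ h2.self_of_nhds)).congr_of_eventuallyEq h4

/-- The derivative at the identity of the equivariance π ∘ L_a = a • π. -/
theorem mfderiv_proj_leftDeriv (a : H × H) (X Y : E) :
    (mfderiv (𝓘(ℝ, E).prod 𝓘(ℝ, E)) 𝓘(ℝ, F) (proj K) a : E × E →L[ℝ] F)
      (leftDeriv a.1 X, leftDeriv a.2 Y) = smulDeriv F K a (projDeriv E F K (X, Y)) := by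
  have hπ : ∀ b, MDifferentiableAt (𝓘(ℝ, E).prod 𝓘(ℝ, E)) 𝓘(ℝ, F) (proj K) b := fun b =>
    (contMDiff_proj hM).contMDiffAt.mdifferentiableAt (by simp)
  have h1 : HasMFDerivAt (𝓘(ℝ, E).prod 𝓘(ℝ, E)) 𝓘(ℝ, F) (proj K) (a * 1)
      (mfderiv (𝓘(ℝ, E).prod 𝓘(ℝ, E)) 𝓘(ℝ, F) (proj K) a : E × E →L[ℝ] F) := by
    rw [mul_one]
    exact (hπ a).hasMFDerivAt
  have h2 : HasMFDerivAt (𝓘(ℝ, E).prod 𝓘(ℝ, E)) (𝓘(ℝ, E).prod 𝓘(ℝ, E)) (fun x : H × H => a * x) 1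
      ((leftDeriv (E := E) a.1).prodMap (leftDeriv a.2)) := by
    have h := ((contMDiff_mul_left_prod (E := E) a).contMDiffAt (x := 1)).mdifferentiableAt (by simp)
    have e : mfderiv (𝓘(ℝ, E).prod 𝓘(ℝ, E)) (𝓘(ℝ, E).prod 𝓘(ℝ, E)) (fun x : H × H => a * x) 1 =
        (leftDeriv (E := E) a.1).prodMap (leftDeriv a.2) :=
      mfderiv_prodMap (p := (1 : H × H)) (f := fun x => a.1 * x) (g := fun x => a.2 * x)
        ((contMDiff_mul_left (I := 𝓘(ℝ, E)) (n := ∞)).contMDiffAt.mdifferentiableAt (by simp))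
        ((contMDiff_mul_left (I := 𝓘(ℝ, E)) (n := ∞)).contMDiffAt.mdifferentiableAt (by simp))
    have := h.hasMFDerivAt
    rw [e] at this
    exact this
  have h3 := HasMFDerivAt.comp _ h1 h2
  have h4 := HasMFDerivAt.comp (1 : H × H) (((contMDiff_smul_quotient hM a).contMDiffAt
    (x := proj K 1)).mdifferentiableAt (by simp)).hasMFDerivAt (hπ 1).hasMFDerivAt
  have h5 := hasMFDerivAt_unique h3 h4
  exact congrArg (fun L : E × E →L[ℝ] F => L (X, Y)) h5

variable [IsManifold 𝓘(ℝ, F) ∞ (DiagQuotient K)]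

theorem exists_lift (p : DiagQuotient K) : ∃ σ : F → H × H,
    ∀ᶠ u in 𝓝 (extChartAt 𝓘(ℝ, F) p p), ContMDiffAt 𝓘(ℝ, F) (𝓘(ℝ, E).prod 𝓘(ℝ, E)) ∞ σ u ∧
      proj K (σ u) = (extChartAt 𝓘(ℝ, F) p).symm u := by
  obtain ⟨b, hb⟩ := exists_proj_eq K p
  obtain ⟨s, -, h2, h3⟩ := exists_section_proj hM b
  have hc : ∀ᶠ u in 𝓝 (extChartAt 𝓘(ℝ, F) p p),
      ContMDiffAt 𝓘(ℝ, F) 𝓘(ℝ, F) ∞ (extChartAt 𝓘(ℝ, F) p).symm u := by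
    filter_upwards [extChartAt_target_mem_nhds (I := 𝓘(ℝ, F)) p] with u hu
    exact (contMDiffOn_extChartAt_symm (n := ∞) p).contMDiffAt
      ((isOpen_extChartAt_target p).mem_nhds hu)
  have ht : Tendsto (extChartAt 𝓘(ℝ, F) p).symm (𝓝 (extChartAt 𝓘(ℝ, F) p p))
      (𝓝 (proj K b)) := by
    have := hc.self_of_nhds.continuousAt.tendsto
    rw [extChartAt_to_inv] at this
    rw [hb]
    exact this
  refine ⟨s ∘ (extChartAt 𝓘(ℝ, F) p).symm, ?_⟩
  filter_upwards [hc, ht.eventually h2, ht.eventually h3] with u h1 h2 h3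
  exact ⟨h2.comp u h1, h3⟩

end Quotient

/-! ### The metric in a chart, through a lift to H × H -/

section Lift

variable {E : Type*} [NormedAddCommGroup E] [NormedSpace ℝ E]
  {H : Type*} [TopologicalSpace H] [ChartedSpace E H] [Group H] [LieGroup 𝓘(ℝ, E) ∞ H]
  {F : Type*} [NormedAddCommGroup F] [NormedSpace ℝ F]

/-- The pullback of the Maurer-Cartan form of `H × H`. -/
def mcPair (E : Type*) [NormedAddCommGroup E] [NormedSpace ℝ E]
    {H : Type*} [TopologicalSpace H] [ChartedSpace E H] [Group H] (σ : F → H × H) (u : F) :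
    F →L[ℝ] E × E :=
  (mcForm E (fun x => (σ x).1) u).prod (mcForm E (fun x => (σ x).2) u)

variable {K : Subgroup H} [ChartedSpace F (DiagQuotient K)] (hM : IsStandardSmoothStructure E F K)
  [IsManifold 𝓘(ℝ, F) ∞ (DiagQuotient K)]

-- Differentiate π ∘ σ = chart⁻¹, write dσ as a left translate of η, and use equivariance of π.
include hM in
theorem mfderiv_chart_symm_eq {p : DiagQuotient K} {σ : F → H × H} {u : F}
    (hσ : ContMDiffAt 𝓘(ℝ, F) (𝓘(ℝ, E).prod 𝓘(ℝ, E)) ∞ σ u)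
    (hp : ∀ᶠ x in 𝓝 u, proj K (σ x) = (extChartAt 𝓘(ℝ, F) p).symm x) (v : F) :
    (mfderiv 𝓘(ℝ, F) 𝓘(ℝ, F) (extChartAt 𝓘(ℝ, F) p).symm u : F →L[ℝ] F) v =
      smulDeriv F K (σ u) (projDeriv E F K (mcPair E σ u v)) := by
  have h1 : MDifferentiableAt 𝓘(ℝ, F) 𝓘(ℝ, E) (fun x => (σ x).1) u :=
    (contMDiffAt_fst.comp u hσ).mdifferentiableAt (by simp)
  have h2 : MDifferentiableAt 𝓘(ℝ, F) 𝓘(ℝ, E) (fun x => (σ x).2) u :=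
    (contMDiffAt_snd.comp u hσ).mdifferentiableAt (by simp)
  have h3 : HasMFDerivAt 𝓘(ℝ, F) (𝓘(ℝ, E).prod 𝓘(ℝ, E)) σ u
      ((derivTo E (fun x => (σ x).1) u).prod (derivTo E (fun x => (σ x).2) u)) :=
    h1.hasMFDerivAt.prodMk h2.hasMFDerivAt
  have h4 := HasMFDerivAt.comp u (((contMDiff_proj hM).contMDiffAt
    (x := σ u)).mdifferentiableAt (by simp)).hasMFDerivAt h3
  have h5 : (extChartAt 𝓘(ℝ, F) p).symm =ᶠ[𝓝 u] proj K ∘ σ := hp.mono fun x hx => hx.symm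
  have h6 := (h4.congr_of_eventuallyEq h5).mfderiv
  have h7 : (mfderiv 𝓘(ℝ, F) 𝓘(ℝ, F) (extChartAt 𝓘(ℝ, F) p).symm u : F →L[ℝ] F) v =
      (mfderiv (𝓘(ℝ, E).prod 𝓘(ℝ, E)) 𝓘(ℝ, F) (proj K) (σ u) : E × E →L[ℝ] F)
        (derivTo E (fun x => (σ x).1) u v, derivTo E (fun x => (σ x).2) u v) :=
    congrArg (fun L : F →L[ℝ] F => L v) h6
  rw [h7, ← leftDeriv_mcForm (fun x => (σ x).1), ← leftDeriv_mcForm (fun x => (σ x).2),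
    mfderiv_proj_leftDeriv hM]
  rfl

/-- The value at the base point of a metric on the homogeneous space. -/
def baseForm [FiniteDimensional ℝ F] (g : SmoothMetric F (DiagQuotient K)) :
    F →L[ℝ] F →L[ℝ] ℝ :=
  g.inner (proj K 1)

-- Invariance cancels the differential of the action of σ(u), leaving only the form at the base
-- point evaluated on Pη.
include hM in
theorem inChart_eq [FiniteDimensional ℝ F] {g : SmoothMetric F (DiagQuotient K)}
    (hg : IsInvariantMetric g) {p : DiagQuotient K} {σ : F → H × H} {u : F}
    (hσ : ContMDiffAt 𝓘(ℝ, F) (𝓘(ℝ, E).prod 𝓘(ℝ, E)) ∞ σ u)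
    (hp : ∀ᶠ x in 𝓝 u, proj K (σ x) = (extChartAt 𝓘(ℝ, F) p).symm x) :
    g.inChart p u = (baseForm g).bilinearComp (projDeriv E F K ∘L mcPair E σ u)
      (projDeriv E F K ∘L mcPair E σ u) := by
  ext v w
  have h1 : σ u • proj K 1 = (extChartAt 𝓘(ℝ, F) p).symm u := by
    rw [smul_proj, mul_one]
    exact hp.self_of_nhds
  have h2 := hg (σ u) (proj K 1) (projDeriv E F K (mcPair E σ u v))
    (projDeriv E F K (mcPair E σ u w))
  have h3 : ∀ q : DiagQuotient K, σ u • proj K 1 = q →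
      (g.inner q : F →L[ℝ] F →L[ℝ] ℝ) (smulDeriv F K (σ u) (projDeriv E F K (mcPair E σ u v)))
        (smulDeriv F K (σ u) (projDeriv E F K (mcPair E σ u w))) =
      baseForm g (projDeriv E F K (mcPair E σ u v)) (projDeriv E F K (mcPair E σ u w)) := by
    rintro _ rfl
    exact h2
  have h4 := h3 _ h1
  rw [← mfderiv_chart_symm_eq hM hσ hp, ← mfderiv_chart_symm_eq hM hσ hp] at h4
  exact h4

-- Pη followed by the differential of the action is the derivative of the inverse chart. So Pη is
-- injective, and an injective endomorphism in finite dimension is invertible.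
include hM in
theorem isInvertible_projDeriv_mcPair [FiniteDimensional ℝ F] {p : DiagQuotient K}
    {σ : F → H × H} {u : F} (hu : u ∈ (extChartAt 𝓘(ℝ, F) p).target)
    (hσ : ContMDiffAt 𝓘(ℝ, F) (𝓘(ℝ, E).prod 𝓘(ℝ, E)) ∞ σ u)
    (hp : ∀ᶠ x in 𝓝 u, proj K (σ x) = (extChartAt 𝓘(ℝ, F) p).symm x) :
    (projDeriv E F K ∘L mcPair E σ u).IsInvertible := by
  let L : F →L[ℝ] F := mfderiv 𝓘(ℝ, F) 𝓘(ℝ, F) (extChartAt 𝓘(ℝ, F) p).symm u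
  have hL : L.IsInvertible := by
    have : IsManifold 𝓘(ℝ, F) 1 (DiagQuotient K) := IsManifold.of_le (n := ∞) (by simp)
    have := isInvertible_mfderivWithin_extChartAt_symm (I := 𝓘(ℝ, F)) hu
    simp only [modelWithCornersSelf_coe, Set.range_id, mfderivWithin_univ] at this
    exact this
  obtain ⟨e, he⟩ := hL
  have hinj : Function.Injective (projDeriv E F K ∘L mcPair E σ u : F →ₗ[ℝ] F) := by
    refine (injective_iff_map_eq_zero _).2 fun v hv => ?_
    have h1 := mfderiv_chart_symm_eq hM hσ hp v
    have h2 : projDeriv E F K (mcPair E σ u v) = 0 := hv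
    rw [h2, map_zero] at h1
    have h3 : e v = 0 := (congrArg (fun A : F →L[ℝ] F => A v) he).trans h1
    exact e.map_eq_zero_iff.1 h3
  exact ⟨(LinearEquiv.ofInjectiveEndo _ hinj).toContinuousLinearEquiv, by ext; rfl⟩

variable [CompleteSpace E] [FiniteDimensional ℝ E] [FiniteDimensional ℝ F]

theorem contDiffAt_mcPair {σ : F → H × H} {u : F}
    (hσ : ∀ᶠ x in 𝓝 u, ContMDiffAt 𝓘(ℝ, F) (𝓘(ℝ, E).prod 𝓘(ℝ, E)) ∞ σ x) :
    ContDiffAt ℝ 2 (mcPair E σ) u ∧ ∀ v w, fderiv ℝ (mcPair E σ) u v w -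
      fderiv ℝ (mcPair E σ) u w v =
        -(modelBracket E H (mcPair E σ u v).1 (mcPair E σ u w).1,
          modelBracket E H (mcPair E σ u v).2 (mcPair E σ u w).2) := by
  have h1 : ∀ᶠ x in 𝓝 u, ContMDiffAt 𝓘(ℝ, F) 𝓘(ℝ, E) ∞ (fun x => (σ x).1) x :=
    hσ.mono fun x hx => contMDiffAt_fst.comp x hx
  have h2 : ∀ᶠ x in 𝓝 u, ContMDiffAt 𝓘(ℝ, F) 𝓘(ℝ, E) ∞ (fun x => (σ x).2) x :=
    hσ.mono fun x hx => contMDiffAt_snd.comp x hx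
  have c1 := contDiffAt_mcForm h1
  have c2 := contDiffAt_mcForm h2
  have hc : ContDiffAt ℝ 2 (mcPair E σ) u := by
    exact contDiffAt_clm_of_apply fun y =>
      (c1.clm_apply contDiffAt_const).prodMk (c2.clm_apply contDiffAt_const)
  refine ⟨hc, fun v w => ?_⟩
  have d : ∀ v w, fderiv ℝ (mcPair E σ) u v w =
      (fderiv ℝ (mcForm E (fun x => (σ x).1)) u v w,
        fderiv ℝ (mcForm E (fun x => (σ x).2)) u v w) := fun v w => by
    have e1 := ((hc.differentiableAt (by simp)).hasFDerivAt.clm_apply (hasFDerivAt_const w u))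
    have e2 : HasFDerivAt (fun x => mcPair E σ x w) _ u :=
      ((c1.differentiableAt (by simp)).hasFDerivAt.clm_apply (hasFDerivAt_const w u)).prodMk
        ((c2.differentiableAt (by simp)).hasFDerivAt.clm_apply (hasFDerivAt_const w u))
    have := congrArg (fun A => A v) (e1.unique e2)
    simpa using this
  rw [d, d, Prod.mk_sub_mk, maurerCartan h1, maurerCartan h2]
  rfl

end Lift

/-! ### Frames and forms obtained from the hypotheses -/

namespace SymmetricFrame

/-- The frame of an involution of a Lie algebra whose Killing form is negative definite. -/
theorem exists_of_involution {L : Type*} [LieRing L] [LieAlgebra ℝ L] [FiniteDimensional ℝ L]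
    (θ : L ≃ₗ⁅ℝ⁆ L) (hθ : ∀ x, θ (θ x) = x) (k : Submodule ℝ L) (hk : ∀ x, θ x = x ↔ x ∈ k)
    (hk' : ∀ x ∈ k, x ≠ 0 → 0 < -killingForm ℝ L x x)
    (hq' : ∀ x ∈ (killingForm ℝ L).orthogonal k, x ≠ 0 → 0 < -killingForm ℝ L x x) :
    ∃ S : SymmetricFrame L (Fin (Module.finrank ℝ ((killingForm ℝ L).orthogonal k)))
      (Fin (Module.finrank ℝ k)), (∀ x, S.θ x = x ↔ x ∈ k) ∧
        ∀ x, S.θ x = -x → x ∈ (killingForm ℝ L).orthogonal k := by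
  have hB : ∀ x y, killingForm ℝ L (θ x) (θ y) = killingForm ℝ L x y := fun x y =>
    LieAlgebra.killingForm_of_equiv_apply θ x y
  have hc : ∀ x y, killingForm ℝ L x y = killingForm ℝ L y x := fun x y =>
    LieModule.traceForm_comm ℝ L L x y
  have h1 : ∀ x, θ x = -x → x ∈ (killingForm ℝ L).orthogonal k := fun x hx => by
    rw [LinearMap.BilinForm.mem_orthogonal_iff]
    intro z hz
    have := hB z x
    rw [(hk z).2 hz, hx, map_neg] at this
    have : killingForm ℝ L z x = 0 := by linarith
    exact this
  -- The vector x + θx lies in 𝔨 and is orthogonal to x. It is also orthogonal to θx, as θ is an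
  -- isometry fixing it. So it is orthogonal to itself, and definiteness on 𝔨 makes it zero.
  have h2 : ∀ x ∈ (killingForm ℝ L).orthogonal k, θ x = -x := fun x hx => by
    have hf : x + θ x ∈ k := (hk _).1 (by rw [map_add, hθ, add_comm])
    have hz : ∀ z ∈ k, killingForm ℝ L z x = 0 := (LinearMap.BilinForm.mem_orthogonal_iff.1 hx)
    by_contra h
    have hne : x + θ x ≠ 0 := fun h0 => h (eq_neg_of_add_eq_zero_right h0)
    have h3 := hk' _ hf hne
    have h4 := hB (x + θ x) x
    rw [(hk _).2 hf, hz _ hf] at h4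
    rw [map_add (killingForm ℝ L (x + θ x)), hz _ hf, h4] at h3
    simp at h3
  obtain ⟨q, hqo, hqe⟩ := exists_orthonormal_basis_of_posDef
    ((-killingForm ℝ L).restrict ((killingForm ℝ L).orthogonal k))
    (fun x y => congrArg Neg.neg (hc x y))
    (fun x hx => hq' x x.2 fun h => hx (Subtype.ext h))
  obtain ⟨e, heo, hee⟩ := exists_orthonormal_basis_of_posDef
    ((-killingForm ℝ L).restrict k)
    (fun x y => congrArg Neg.neg (hc x y))
    (fun x hx => hk' x x.2 fun h => hx (Subtype.ext h))
  refine ⟨{ B := -killingForm ℝ L, B_eq := fun _ _ => rfl, θ := θ, invol := hθ,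
            q := fun i => q i, k := fun i => e i, θ_q := fun i => h2 _ (q i).2,
            θ_k := fun i => (hk _).2 (e i).2, q_orth := hqo, k_orth := heo,
            q_expand := fun x hx => ?_, k_expand := fun x hx => ?_ }, hk, h1⟩
  · have := congrArg Subtype.val (hqe ⟨x, h1 x hx⟩)
    rw [Submodule.coe_sum] at this
    exact this
  · have := congrArg Subtype.val (hee ⟨x, (hk x).1 hx⟩)
    rw [Submodule.coe_sum] at this
    exact this

/-- Every vector of `L × L` is a combination of the frame up to the diagonal of the fixed
subalgebra. -/
theorem exists_expansion {L : Type*} [LieRing L] [LieAlgebra ℝ L] {α κ : Type*} [Fintype α]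
    [Fintype κ] [DecidableEq α] [DecidableEq κ] (S : SymmetricFrame L α κ) (X : L × L) :
    ∃ z, S.θ z = z ∧ X = (S.Q X.1, S.Q X.2) + (S.K ((1 / 2 : ℝ) • (X.1 - X.2)),
      -S.K ((1 / 2 : ℝ) • (X.1 - X.2))) + (z, z) := by
  refine ⟨S.K ((1 / 2 : ℝ) • (X.1 + X.2)), S.θ_K _, Prod.ext ?_ ?_⟩
  · have : X.1 = (1 / 2 : ℝ) • (X.1 - X.2) + (1 / 2 : ℝ) • (X.1 + X.2) := by module
    simp only [Prod.fst_add, add_assoc, ← map_add, ← this, S.Q_add_K]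
  · have : X.2 = -((1 / 2 : ℝ) • (X.1 - X.2)) + (1 / 2 : ℝ) • (X.1 + X.2) := by module
    simp only [Prod.snd_add, add_assoc, ← map_add, ← map_neg, ← this, S.Q_add_K]

/-- Modulo the diagonal of 𝔨, which P kills, every pair splits into components in (𝔮, 𝔮) and {(Z,
-Z)}, where the values of β are prescribed. -/
theorem apply_eq_form {L F : Type*} [LieRing L] [LieAlgebra ℝ L] [FiniteDimensional ℝ L]
    {α κ : Type*} [Fintype α] [Fintype κ] [DecidableEq α] [DecidableEq κ]
    [NormedAddCommGroup F] [NormedSpace ℝ F] (S : SymmetricFrame L α κ) {x₁ x₂ x₃ x₄ : ℝ}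
    (β : F →L[ℝ] F →L[ℝ] ℝ) (hβ : ∀ f f', β f f' = β f' f) (P : L × L → F)
    (hP : ∀ A B, P (A + B) = P A + P B) (h0 : ∀ z, S.θ z = z → P (z, z) = 0)
    (hqq : ∀ a, S.θ a = -a → ∀ b, S.θ b = -b → ∀ c, S.θ c = -c → ∀ d, S.θ d = -d →
      β (P (a, b)) (P (c, d)) = x₁ * S.B a c + x₂ * S.B b d + x₄ * (S.B a d + S.B b c))
    (hqk : ∀ a, S.θ a = -a → ∀ b, S.θ b = -b → ∀ z, S.θ z = z → β (P (a, b)) (P (z, -z)) = 0)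
    (hkk : ∀ z, S.θ z = z → ∀ w, S.θ w = w → β (P (z, -z)) (P (w, -w)) = 2 * x₃ * S.B z w)
    (X Y : L × L) : β (P X) (P Y) = S.form x₁ x₂ x₃ x₄ X Y := by
  obtain ⟨z, hz, hX⟩ := S.exists_expansion X
  obtain ⟨z', hz', hY⟩ := S.exists_expansion Y
  conv_lhs => rw [hX, hY, hP, hP, hP, hP, h0 z hz, h0 z' hz', add_zero, add_zero]
  simp only [map_add, add_apply]
  rw [hβ (P (S.K _, _)) (P (S.Q _, _)), hqk _ (S.θ_Q _) _ (S.θ_Q _) _ (S.θ_K _),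
    hqk _ (S.θ_Q _) _ (S.θ_Q _) _ (S.θ_K _), hkk _ (S.θ_K _) _ (S.θ_K _),
    hqq _ (S.θ_Q _) _ (S.θ_Q _) _ (S.θ_Q _) _ (S.θ_Q _)]
  simp only [S.B_Q_left, S.B_K_left, map_smul, LinearMap.smul_apply, smul_eq_mul, form]
  ring

end SymmetricFrame

section Assembly

variable {E : Type*} [NormedAddCommGroup E] [NormedSpace ℝ E] [CompleteSpace E]
  {H : Type*} [TopologicalSpace H] [ChartedSpace E H] [Group H] [LieGroup 𝓘(ℝ, E) ∞ H]
  {K : Subgroup H} {F : Type*} [NormedAddCommGroup F] [NormedSpace ℝ F] [FiniteDimensional ℝ F]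
  [ChartedSpace F (DiagQuotient K)] [IsManifold 𝓘(ℝ, F) ∞ (DiagQuotient K)]
  {g : SmoothMetric F (DiagQuotient K)} {x₁ x₂ x₃ x₄ : ℝ}

theorem baseForm_pos (g : SmoothMetric F (DiagQuotient K)) {f : F} (hf : f ≠ 0) :
    0 < baseForm g f f :=
  g.pos (proj K 1) f hf

theorem baseForm_comm (g : SmoothMetric F (DiagQuotient K)) (f f' : F) :
    baseForm g f f' = baseForm g f' f :=
  g.symm (proj K 1) f f'

/-- For Z ≠ 0 the vector (Z, -Z) is off the diagonal, so its image is a nonzero tangent vector with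
squared length 2x₃ · (-kil(Z, Z)) > 0. The definiteness on 𝔮 below is obtained in the same way from
(X, 0). -/
theorem HasParameters.neg_kil_pos_of_mem_subgroupLieAlg (hg : HasParameters E g x₁ x₂ x₃ x₄)
    (hM : IsStandardSmoothStructure E F K) (hx₃ : 0 < x₃) {Z : LieAlg E H}
    (hZ : Z ∈ subgroupLieAlg E K) (h0 : Z ≠ 0) : 0 < -kil E H Z Z := by
  have h1 : projDeriv E F K (Z, -Z) ≠ 0 := fun h => by
    have h2 : -Z = Z := ((projDeriv_eq_zero_iff hM _ _).1 h).2
    have h3 : (2 : ℝ) • Z = 0 := by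
      rw [two_smul]
      nth_rewrite 1 [← h2]
      exact neg_add_cancel Z
    exact h0 ((smul_eq_zero.1 h3).resolve_left two_ne_zero)
  have h2 := (baseForm_pos g h1).trans_eq (hg.on_p₃ Z hZ Z hZ)
  exact (mul_pos_iff_of_pos_left (by positivity)).1 h2

theorem HasParameters.neg_kil_pos_of_mem_isotropySpace (hg : HasParameters E g x₁ x₂ x₃ x₄)
    (hM : IsStandardSmoothStructure E F K) (hx₁ : 0 < x₁) {X : LieAlg E H}
    (hX : X ∈ isotropySpace E K) (h0 : X ≠ 0) : 0 < -kil E H X X := by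
  have h1 : projDeriv E F K (X, (0 : LieAlg E H)) ≠ 0 := fun h =>
    h0 (((projDeriv_eq_zero_iff hM _ _).1 h).2).symm
  have h2 := (baseForm_pos g h1).trans_eq
    (hg.on_p₁₂ X hX 0 (Submodule.zero_mem _) X hX 0 (Submodule.zero_mem _))
  simp only [map_zero, LinearMap.zero_apply, neg_zero, mul_zero, add_zero] at h2
  exact (mul_pos_iff_of_pos_left hx₁).1 h2

theorem HasParameters.baseForm_projDeriv [FiniteDimensional ℝ E] (hg : HasParameters E g x₁ x₂ x₃ x₄)
    (hM : IsStandardSmoothStructure E F K) {α κ : Type*} [Fintype α]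
    [Fintype κ] [DecidableEq α] [DecidableEq κ] (S : SymmetricFrame (LieAlg E H) α κ)
    (hk : ∀ x, S.θ x = x → x ∈ subgroupLieAlg E K)
    (hq : ∀ x, S.θ x = -x → x ∈ isotropySpace E K) (X Y : LieAlg E H × LieAlg E H) :
    baseForm g (projDeriv E F K X) (projDeriv E F K Y) = S.form x₁ x₂ x₃ x₄ X Y := by
  have hfd : FiniteDimensional ℝ (LieAlg E H) := inferInstanceAs (FiniteDimensional ℝ E)
  have hB : ∀ x y, S.B x y = -kil E H x y := fun x y => S.B_eq x y
  refine S.apply_eq_form (baseForm g) (baseForm_comm g) (fun X => projDeriv E F K X)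
    (fun A B => map_add (projDeriv E F K) A B)
    (fun z hz => (projDeriv_eq_zero_iff hM _ _).2 ⟨hk z hz, rfl⟩) ?_ ?_ ?_ X Y
  · intro a ha b hb c hc d hd
    simp only [hB]
    exact hg.on_p₁₂ _ (hq a ha) _ (hq b hb) _ (hq c hc) _ (hq d hd)
  · intro a ha b hb z hz
    exact hg.on_p₁₂_p₃ _ (hq a ha) _ (hq b hb) _ (hk z hz)
  · intro z hz w hw
    rw [hB]
    exact hg.on_p₃ _ (hk z hz) _ (hk w hw)

end Assembly

namespace SymmetricFrame

/-- Completeness of the frame: modulo the radical of the form it spans L × L. The functional form(X,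
·) is encoded by a, b in 𝔮 and c in 𝔨, and testing on the frame forces all three to vanish. -/
theorem form_eq_zero_of_form_ev {L : Type*} [LieRing L] [LieAlgebra ℝ L] [FiniteDimensional ℝ L]
    {α κ : Type*} [Fintype α] [Fintype κ] [DecidableEq α] [DecidableEq κ]
    (S : SymmetricFrame L α κ) {x₁ x₂ x₃ x₄ : ℝ} {v w : Fin 2 → ℝ} {r : ℝ}
    (hr : 2 * x₃ * r ^ 2 = 1)
    (hvw : ∀ s t, x₁ * v s * v t + x₂ * w s * w t + x₄ * (v s * w t + w s * v t) =
      if s = t then 1 else 0) {X : L × L}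
    (h : ∀ i, S.form x₁ x₂ x₃ x₄ X (S.ev v w r i) = 0) (Y : L × L) :
    S.form x₁ x₂ x₃ x₄ X Y = 0 := by
  obtain ⟨a, ha⟩ : ∃ a, a = x₁ • S.Q X.1 + x₄ • S.Q X.2 := ⟨_, rfl⟩
  obtain ⟨b, hb⟩ : ∃ b, b = x₂ • S.Q X.2 + x₄ • S.Q X.1 := ⟨_, rfl⟩
  obtain ⟨c, hc⟩ : ∃ c, c = S.K (X.1 - X.2) := ⟨_, rfl⟩
  have hf : ∀ Y, S.form x₁ x₂ x₃ x₄ X Y = S.B a Y.1 + S.B b Y.2 + x₃ / 2 * S.B c (Y.1 - Y.2) :=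
    fun Y => by
      simp only [form, ha, hb, hc, map_add, map_smul, LinearMap.add_apply, LinearMap.smul_apply,
        smul_eq_mul]
      ring
  have ha' : S.θ a = -a := by
    simp only [ha, map_add, map_smul, S.θ_Q, smul_neg, neg_add]
  have hb' : S.θ b = -b := by
    simp only [hb, map_add, map_smul, S.θ_Q, smul_neg, neg_add]
  have hc' : S.θ c = c := hc ▸ S.θ_K _
  -- Taking determinants in the orthonormality relations gives (x₁x₂ - x₄²) · det² = 1.
  have hdet : v 0 * w 1 - w 0 * v 1 ≠ 0 := fun h0 => by
    have h1 := hvw 0 0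
    have h2 := hvw 0 1
    have h3 := hvw 1 1
    simp only [if_true, Fin.zero_eq_one_iff, OfNat.ofNat_ne_one, if_false] at h1 h2 h3
    have : (x₁ * x₂ - x₄ ^ 2) * (v 0 * w 1 - w 0 * v 1) ^ 2 = 1 := by
      linear_combination (x₁ * v 1 * v 1 + x₂ * w 1 * w 1 + x₄ * (v 1 * w 1 + w 1 * v 1)) * h1 +
        h3 - (x₁ * v 0 * v 1 + x₂ * w 0 * w 1 + x₄ * (v 0 * w 1 + w 0 * v 1)) * h2
    rw [h0] at this
    norm_num at this
  have hq : ∀ s i, v s * S.B a (S.q i) + w s * S.B b (S.q i) = 0 := fun s i => by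
    have := h (.inl (s, i))
    rw [hf] at this
    simp only [ev, ← sub_smul, map_smul, S.B_of_pos_of_neg hc' (S.θ_q i), smul_eq_mul, mul_zero,
      add_zero] at this
    exact this
  have ha0 : a = 0 := by
    rw [← S.q_expand a ha']
    refine Finset.sum_eq_zero fun i _ => ?_
    have : (v 0 * w 1 - w 0 * v 1) * S.B a (S.q i) = 0 := by
      linear_combination w 1 * hq 0 i - w 0 * hq 1 i
    rw [(mul_eq_zero.1 this).resolve_left hdet, zero_smul]
  have hb0 : b = 0 := by
    rw [← S.q_expand b hb']
    refine Finset.sum_eq_zero fun i _ => ?_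
    have : (v 0 * w 1 - w 0 * v 1) * S.B b (S.q i) = 0 := by
      linear_combination v 0 * hq 1 i - v 1 * hq 0 i
    rw [(mul_eq_zero.1 this).resolve_left hdet, zero_smul]
  have hc0 : c = 0 := by
    rw [← S.k_expand c hc']
    refine Finset.sum_eq_zero fun i _ => ?_
    have h1 := h (.inr i)
    rw [hf] at h1
    simp only [ev, ha0, hb0, ← sub_smul, map_smul, map_zero, LinearMap.zero_apply,
      smul_eq_mul] at h1
    have : S.B c (S.k i) = 0 := by
      linear_combination 2 * r * h1 - S.B c (S.k i) * hr
    rw [this, zero_smul]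
  simp [hf, ha0, hb0, hc0]

end SymmetricFrame

/-! ### The homogeneous model of the invariant metric, and the conclusion -/

section Model

variable {E : Type*} [NormedAddCommGroup E] [NormedSpace ℝ E] [CompleteSpace E]
  {H : Type*} [TopologicalSpace H] [ChartedSpace E H] [Group H] [LieGroup 𝓘(ℝ, E) ∞ H]

theorem modelBracket_add_left (X Y Z : E) :
    modelBracket E H (X + Y) Z = modelBracket E H X Z + modelBracket E H Y Z :=
  add_lie (L := LieAlg E H) (M := LieAlg E H) X Y Z

theorem modelBracket_add_right (X Y Z : E) :
    modelBracket E H X (Y + Z) = modelBracket E H X Y + modelBracket E H X Z :=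
  lie_add (L := LieAlg E H) (M := LieAlg E H) X Y Z

theorem modelBracket_smul_left (c : ℝ) (X Y : E) :
    modelBracket E H (c • X) Y = c • modelBracket E H X Y :=
  smul_lie (L := LieAlg E H) (M := LieAlg E H) c X Y

theorem modelBracket_smul_right (c : ℝ) (X Y : E) :
    modelBracket E H X (c • Y) = c • modelBracket E H X Y :=
  lie_smul (L := LieAlg E H) (M := LieAlg E H) c X Y

theorem modelBracket_skew (X Y : E) : modelBracket E H X Y = -modelBracket E H Y X :=
  (lie_skew (L := LieAlg E H) X Y).symm

theorem modelBracket_jacobi (X Y Z : E) : modelBracket E H X (modelBracket E H Y Z) =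
    modelBracket E H (modelBracket E H X Y) Z + modelBracket E H Y (modelBracket E H X Z) :=
  leibniz_lie (L₁ := LieAlg E H) (L₂ := LieAlg E H) (M := LieAlg E H) X Y Z

/-- The Lie bracket of `H × H`, on the model space. -/
def pairBracket (E : Type*) [NormedAddCommGroup E] [NormedSpace ℝ E] [FiniteDimensional ℝ E]
    [CompleteSpace E] (H : Type*) [TopologicalSpace H] [ChartedSpace E H] [Group H]
    [LieGroup 𝓘(ℝ, E) ∞ H] : (E × E) →L[ℝ] (E × E) →L[ℝ] (E × E) :=
  (LinearMap.mk₂ ℝ (fun X Y : E × E => (modelBracket E H X.1 Y.1, modelBracket E H X.2 Y.2))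
    (fun _ _ _ => Prod.ext (modelBracket_add_left _ _ _) (modelBracket_add_left _ _ _))
    (fun _ _ _ => Prod.ext (modelBracket_smul_left _ _ _) (modelBracket_smul_left _ _ _))
    (fun _ _ _ => Prod.ext (modelBracket_add_right _ _ _) (modelBracket_add_right _ _ _))
    (fun _ _ _ => Prod.ext (modelBracket_smul_right _ _ _)
      (modelBracket_smul_right _ _ _))).toContinuousBilinearMap

theorem pairBracket_apply [FiniteDimensional ℝ E] (X Y : E × E) :
    pairBracket E H X Y = (modelBracket E H X.1 Y.1, modelBracket E H X.2 Y.2) := rfl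

variable [FiniteDimensional ℝ E] {K : Subgroup H} {F : Type*} [NormedAddCommGroup F] [NormedSpace ℝ F]
  [FiniteDimensional ℝ F]
  [ChartedSpace F (DiagQuotient K)] [IsManifold 𝓘(ℝ, F) ∞ (DiagQuotient K)]

/-- The infinitesimal model of an invariant metric on `(H × H) / ΔK`. -/
def homogeneousModel {α κ : Type*} [Fintype α] [Fintype κ] [DecidableEq α] [DecidableEq κ]
    (S : SymmetricFrame (LieAlg E H) α κ) (g : SmoothMetric F (DiagQuotient K))
    {x₁ x₂ x₃ x₄ : ℝ} {v w : Fin 2 → ℝ} {r : ℝ} (hM : IsStandardSmoothStructure E F K)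
    (hk : ∀ x, x ∈ subgroupLieAlg E K → S.θ x = x)
    (hform : ∀ X Y : LieAlg E H × LieAlg E H,
      baseForm g (projDeriv E F K X) (projDeriv E F K Y) = S.form x₁ x₂ x₃ x₄ X Y)
    (hr : 2 * x₃ * r ^ 2 = 1)
    (hvw : ∀ s t, x₁ * v s * v t + x₂ * w s * w t + x₄ * (v s * w t + w s * v t) =
      if s = t then 1 else 0) : HomogeneousModel (E × E) F ((Fin 2 × α) ⊕ κ) where
  br := pairBracket E H
  P := projDeriv E F K
  β := baseForm g
  e := S.ev v w r
  skew X Y := Prod.ext (modelBracket_skew X.1 Y.1) (modelBracket_skew X.2 Y.2)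
  jacobi X Y Z := Prod.ext (modelBracket_jacobi X.1 Y.1 Z.1) (modelBracket_jacobi X.2 Y.2 Z.2)
  symm := baseForm_comm g
  orthonormal i j := by
    have : FiniteDimensional ℝ (LieAlg E H) := inferInstanceAs (FiniteDimensional ℝ E)
    exact (hform _ _).trans (S.form_ev hr hvw i j)
  expand f := by
    have : FiniteDimensional ℝ (LieAlg E H) := inferInstanceAs (FiniteDimensional ℝ E)
    obtain ⟨c, hc⟩ : ∃ c : (Fin 2 × α) ⊕ κ → E × E, c = S.ev v w r := ⟨_, rfl⟩
    obtain ⟨W, hW⟩ : ∃ W, ∑ i, baseForm g f (projDeriv E F K (c i)) • projDeriv E F K (c i) =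
        projDeriv E F K W :=
      ⟨∑ i, baseForm g f (projDeriv E F K (c i)) • c i, by simp only [map_sum, map_smul]⟩
    obtain ⟨X, rfl⟩ := projDeriv_surjective hM f
    have ho : ∀ i j, baseForm g (projDeriv E F K (c i)) (projDeriv E F K (c j)) =
        if i = j then 1 else 0 := fun i j => by
      rw [hc]
      exact (hform _ _).trans (S.form_ev hr hvw i j)
    -- The error W - X of the frame expansion is orthogonal to the frame, hence by completeness to
    -- itself; positivity of g then makes its image zero.
    have h1 : ∀ i, baseForm g (projDeriv E F K (W - X)) (projDeriv E F K (c i)) = 0 := fun i => by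
      rw [map_sub, ← hW]
      simp [ho, -Fintype.sum_sum_type]
    have h2 : ∀ i, S.form x₁ x₂ x₃ x₄ (W - X : E × E) (S.ev v w r i) = 0 := fun i => by
      have := h1 i
      rw [hc] at this
      exact (hform _ _).symm.trans this
    rw [← hc, hW]
    by_contra hne
    have h3 : projDeriv E F K (W - X) ≠ 0 := by
      rw [map_sub]
      exact sub_ne_zero.2 hne
    exact (baseForm_pos g h3).ne' ((hform _ _).trans (S.form_eq_zero_of_form_ev hr hvw h2 _))
  invariant Z hZ X Y := by
    have : FiniteDimensional ℝ (LieAlg E H) := inferInstanceAs (FiniteDimensional ℝ E)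
    obtain ⟨z, z'⟩ := Z
    obtain ⟨h1, rfl⟩ := (projDeriv_eq_zero_iff hM z z').1 hZ
    refine add_eq_zero_iff_eq_neg.2 ?_
    rw [pairBracket_apply, pairBracket_apply]
    exact ((hform _ _).trans (S.form_invariant x₁ x₂ x₃ x₄ (hk _ h1) X Y)).trans
      (congrArg Neg.neg (hform _ _).symm)

end Model

end

/-- Let `H` be a compact simple Lie group and `H/K` an irreducible symmetric space, `d = dim K`,
`n = dim H/K`. The scalar curvature of every metric `g = (x₁, x₂, x₃, x₄)` on `(H × H) / ΔK`. -/
theorem proposition3p1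
    {E : Type*} [NormedAddCommGroup E] [NormedSpace ℝ E] [FiniteDimensional ℝ E] [CompleteSpace E]
    {H : Type*} [TopologicalSpace H] [ChartedSpace E H] [Group H] [LieGroup 𝓘(ℝ, E) ∞ H]
    [T2Space H] [CompactSpace H] [LieAlgebra.IsSimple ℝ (LieAlg E H)]
    (K : Subgroup H) (hK : IsIrreducibleSymmetric E K)
    {F : Type*} [NormedAddCommGroup F] [NormedSpace ℝ F] [FiniteDimensional ℝ F]
    [ChartedSpace F (DiagQuotient K)] [IsManifold 𝓘(ℝ, F) ∞ (DiagQuotient K)]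
    (hM : IsStandardSmoothStructure E F K)
    (d n : ℕ) (hd : d = Module.finrank ℝ (subgroupLieAlg E K))
    (hn : n = Module.finrank ℝ (isotropySpace E K))
    (x₁ x₂ x₃ x₄ : ℝ) (hx₁ : 0 < x₁) (hx₂ : 0 < x₂) (hx₃ : 0 < x₃) (hx : x₄ ^ 2 < x₁ * x₂)
    (g : SmoothMetric F (DiagQuotient K)) (hg : HasParameters E g x₁ x₂ x₃ x₄)
    (p : DiagQuotient K) :
    g.scalarCurvature p =
      d / (2 * x₃) -
        n * (x₂ ^ 2 * x₃ ^ 2 + x₁ ^ 2 * (4 * x₂ ^ 2 - 8 * x₂ * x₃ + x₃ ^ 2) + 8 * x₂ * x₃ * x₄ ^ 2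
            + 8 * x₁ * x₃ * (x₄ ^ 2 - x₂ ^ 2) - 2 * x₄ ^ 2 * (x₃ ^ 2 + 2 * x₄ ^ 2))
          / (16 * x₃ * (x₄ ^ 2 - x₁ * x₂) ^ 2) := by
  have hfd : FiniteDimensional ℝ (LieAlg E H) := inferInstanceAs (FiniteDimensional ℝ E)
  obtain ⟨θ, hθ, hθK⟩ := hK.symmetric
  obtain ⟨S, hSk, hSq⟩ := SymmetricFrame.exists_of_involution θ hθ (subgroupLieAlg E K) hθK
    (fun x h h0 => hg.neg_kil_pos_of_mem_subgroupLieAlg hM hx₃ h h0)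
    (fun x h h0 => hg.neg_kil_pos_of_mem_isotropySpace hM hx₁ h h0)
  have hform := hg.baseForm_projDeriv hM S (fun x => (hSk x).1) hSq
  obtain ⟨v, w, r, hr, hvw, hsum⟩ := S.sum_cst_eq hx₁ hx₃ hx
  let D := homogeneousModel S g hM (fun x => (hSk x).2) hform hr hvw
  obtain ⟨σ, hσ⟩ := exists_lift hM p
  have hσ1 := hσ.mono fun _ h => h.1
  have hσ2 := hσ.mono fun _ h => h.2
  -- The scalar curvature depends only on the germ of the metric, so agreement near the centre of
  -- the chart suffices.
  have hG : g.inChart p =ᶠ[𝓝 (extChartAt 𝓘(ℝ, F) p p)] D.metricOf (mcPair E σ) := by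
    filter_upwards [hσ1, eventually_eventually_nhds.2 hσ2] with u h1 h2
    exact inChart_eq hM hg.invariant h1 h2
  have hsc : ∀ i j k, D.sc i j k = S.cst x₁ x₂ x₃ x₄ v w r i j k := fun i j k => hform _ _
  have hdbl : ∀ i j, D.b (D.br (D.br (D.e i) (D.e j)) (D.e j)) (D.e i) =
      S.dbl x₁ x₂ x₃ x₄ v w r i j := fun i j => hform _ _
  rw [SmoothMetric.scalarCurvature, localScalar_congr hG,
    D.localScalar_metricOf (contDiffAt_mcPair hσ1).1
      ((eventually_eventually_nhds.2 hσ1).mono fun x hx => (contDiffAt_mcPair hx).2) ?_,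
    D.sum_curv_eq fun k => by simp only [hsc, S.cst_unimodular]]
  · simp only [hsc, hdbl, hsum, Fintype.card_fin, hd, hn]
    rfl
  · filter_upwards [hσ1, eventually_eventually_nhds.2 hσ2,
      extChartAt_target_mem_nhds (I := 𝓘(ℝ, F)) p] with u h1 h2 h3
    exact isInvertible_projDeriv_mcPair hM h3 h1 h2
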